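/- Let $p>1$ be an integer and let $B=B_{\ell_p}$ be the open unit ball of the complex Banach space $\ell_p$. Let $H_b(B)$ be the algebra of holomorphic functions $f:B\to\mathbb C$ that are bounded on every set $A\subset B$ at positive distance from the complement of $B$, with the topology of uniform convergence on such sets, and let $M_b(B)$ be its spectrum, i.e. the set of nonzero continuous multiplicative linear functionals on $H_b(B)$. Put $\pi(\varphi)=\varphi|_{(\ell_p)'}\in(\ell_p)''=\ell_p$ for $\varphi\in M_b(B)$, and give $M_b(B)$ the topology in which the sets $\{\varphi^z:\ z\in\ell_p,\ \|z\|<\delta\}$, with $\delta>0$ small, form a neighbourhood base at $\varphi$, where $\varphi^z(f)=\sum_{n\ge0}\varphi\big(y\mapsto \frac{d^nf(y)}{n!}(z)\big)$. The sheet $S(\varphi)$ is the connected component of $\varphi$ in $M_b(B)$. Call $\varphi\in M_b(B)$ a block limit with parameter $r\in(0,1)$ if $\varphi(f)=\lim_\Gamma f(x_n)$ for all $f\in H_b(B)$, where $(x_n)$ is a block basis of the unit vector basis with $x_n\in B$ and $\|x_n\|\to r$, and $\Gamma$ is an ultrafilter on $\mathbb N$ containing all the sets $\{n,n+1,\dots\}$;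 every such $(x_n)$ and $\Gamma$ define a point of $M_b(B)$. Let $M_b^0(B)$ be the union of the sheets of all block limits. A Riemann domain over a Banach space $E$ is a Hausdorff space $X$ with a local homeomorphism $q:X\to E$. For $x\in X$ let $dist_X(x)$ be the supremum of the $\rho>0$ such that $q$ maps a neighbourhood of $x$ homeomorphically onto the ball of centre $q(x)$ and radius $\rho$. A holomorphic function on $X$ is of bounded type, i.e. belongs to $H_b(X)$, if it is bounded on every $A\subset X$ with $q(A)$ bounded and $\inf_{x\in A}dist_X(x)>0$. An $H_b$-extension of $X$ is a continuous map $\nu:X\to Z$ into a Riemann domain $(Z,s)$ over $E$ with $s\circ\nu=q$ such that every $f\in H_b(X)$ is $\tilde f\circ\nu$ for a unique holomorphic $\tilde f$ on $Z$. $X$ is an $H_b$-domain of holomorphy if it coincides with its $H_b$-envelope of holomorphy, i.e. for every $H_b$-extension $\nu:X\to Z$ there is a continuous $\mu:Z\to X$ with $q\circ\mu=s$ and $\mu\circ\nu=\mathrm{id}_X$. Then: 1. $M_b^0(B)$ is open in $M_b(B)$, and $(M_b^0(B),\pi)$ is a Riemann domain over $\ell_p$. 2. For every $f\in H_b(B)$,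 its canonical extension $\tilde f(\varphi)=\varphi(f)$ to $M_b^0(B)$ is holomorphic and of bounded type. 3. For every block limit $\varphi$ with parameter $r$, $\pi(S(\varphi))=(1-r^p)^{1/p}B_{\ell_p}$. 4. $M_b^0(B)$ is an $H_b$-domain of holomorphy. -/

import Mathlib

open scoped ENNReal Topology
open Filter Metric TopologicalSpace

universe u v w

noncomputable section

namespace BoundedType

/-! ### Holomorphic functions of bounded type on an open subset of a Banach space -/

section OpenSet

set_option linter.unusedSectionVars false

variable {E : Type u} [NormedAddCommGroup E] [NormedSpace ℂ E]

/-- `A ⊆ U` is `U`-bounded: it is bounded and bounded away from the complement of `U`. -/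
def IsUBounded (U : Opens E) (A : Set U) : Prop :=
  Bornology.IsBounded ((fun x : U => (x : E)) '' A) ∧
    ∃ δ : ℝ, 0 < δ ∧ ∀ x ∈ A, ball (x : E) δ ⊆ (U : Set E)

/-- Extension by zero to the whole space of a function on `U`.  It is only used for talking about
analyticity and derivatives at the points of the open set `U`, where its values off `U` are
irrelevant. -/
def zeroExt (U : Opens E) (f : U → ℂ) : E → ℂ := Function.extend (fun x : U => (x : E)) f 0

theorem zeroExt_apply (U : Opens E) (f : U → ℂ) (x : U) : zeroExt U f x = f x :=
  Subtype.val_injective.extend_apply f 0 x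

theorem zeroExt_eventuallyEq {U : Opens E} {f : U → ℂ} {g : E → ℂ} (x : U)
    (h : ∀ y : U, g y = f y) : g =ᶠ[𝓝 (x : E)] zeroExt U f := by
  filter_upwards [U.isOpen.mem_nhds x.2] with y hy
  exact (h ⟨y, hy⟩).trans (zeroExt_apply U f ⟨y, hy⟩).symm

/-- `f : U → ℂ` is holomorphic: it has a convergent power series expansion at every point. -/
def IsHolo (U : Opens E) (f : U → ℂ) : Prop := ∀ x : U, AnalyticAt ℂ (zeroExt U f) (x : E)

theorem isHolo_of_eq {U : Opens E} {f : U → ℂ} {g : E → ℂ} (h : ∀ y : U, g y = f y)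
    (hg : ∀ y : U, AnalyticAt ℂ g y) : IsHolo U f :=
  fun x => (hg x).congr (zeroExt_eventuallyEq x h)

/-- The function `f : U → ℂ` is bounded on the `U`-bounded sets. -/
def IsBddType (U : Opens E) (f : U → ℂ) : Prop :=
  ∀ A : Set U, IsUBounded U A → ∃ C : ℝ, ∀ x ∈ A, ‖f x‖ ≤ C

/-- The algebra `H_b(U)` of holomorphic functions of bounded type on `U`. -/
def Hb (U : Opens E) : Subalgebra ℂ (U → ℂ) where
  carrier := {f | IsHolo U f ∧ IsBddType U f}
  mul_mem' := by
    rintro f g ⟨hf, hf'⟩ ⟨hg, hg'⟩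
    refine ⟨isHolo_of_eq (g := zeroExt U f * zeroExt U g) (fun y => ?_)
      fun y => (hf y).mul (hg y), fun A hA => ?_⟩
    · simp [zeroExt_apply]
    · obtain ⟨C, hC⟩ := hf' A hA
      obtain ⟨D, hD⟩ := hg' A hA
      refine ⟨C * D, fun x hx => ?_⟩
      rw [Pi.mul_apply, norm_mul]
      exact mul_le_mul (hC x hx) (hD x hx) (norm_nonneg _) ((norm_nonneg _).trans (hC x hx))
  add_mem' := by
    rintro f g ⟨hf, hf'⟩ ⟨hg, hg'⟩
    refine ⟨isHolo_of_eq (g := zeroExt U f + zeroExt U g) (fun y => ?_)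
      fun y => (hf y).add (hg y), fun A hA => ?_⟩
    · simp [zeroExt_apply]
    · obtain ⟨C, hC⟩ := hf' A hA
      obtain ⟨D, hD⟩ := hg' A hA
      exact ⟨C + D, fun x hx => (norm_add_le _ _).trans (add_le_add (hC x hx) (hD x hx))⟩
  algebraMap_mem' := by
    intro c
    exact ⟨isHolo_of_eq (g := fun _ => c) (fun y => rfl) fun y => analyticAt_const,
      fun A _ => ⟨‖c‖, fun x _ => le_rfl⟩⟩

/-- The topology of `H_b(U)`: uniform convergence on the `U`-bounded sets. -/
abbrev hbTopology (U : Opens E) : TopologicalSpace (Hb U) :=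
  TopologicalSpace.induced
    (fun f : Hb U => UniformOnFun.ofFun {A : Set U | IsUBounded U A} (f : U → ℂ)) inferInstance

theorem IsUBounded.enlarge {U : Opens E} {A : Set U} (hA : IsUBounded U A) :
    ∃ δ : ℝ, 0 < δ ∧ (∀ x ∈ A, ball (x : E) δ ⊆ (U : Set E)) ∧
      IsUBounded U {y : U | ∃ x ∈ A, dist (y : E) x ≤ δ / 2} := by
  obtain ⟨hb, δ, hδ, h⟩ := hA
  refine ⟨δ, hδ, h, ?_, δ / 2, half_pos hδ, ?_⟩
  · refine (hb.cthickening (δ := δ / 2)).subset ?_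
    rintro _ ⟨y, ⟨x, hx, hxy⟩, rfl⟩
    exact mem_cthickening_of_dist_le (y : E) (x : E) _ _ ⟨x, hx, rfl⟩ hxy
  · rintro y ⟨x, hx, hxy⟩ w hw
    refine h x hx ?_
    rw [mem_ball] at hw ⊢
    linarith [dist_triangle w (y : E) x]

theorem fderiv_mem_hb (U : Opens E) (z : E) {f : U → ℂ} (hf : f ∈ Hb U) :
    (fun y : U => fderiv ℂ (zeroExt U f) (y : E) z) ∈ Hb U := by
  obtain ⟨ha, hb⟩ := hf
  refine ⟨isHolo_of_eq (g := fun y => fderiv ℂ (zeroExt U f) y z) (fun y => rfl)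
    fun y => ((ContinuousLinearMap.apply ℂ ℂ z).analyticAt _).comp (ha y).fderiv,
    fun A hA => ?_⟩
  obtain ⟨δ, hδ, hball, hA'⟩ := hA.enlarge
  obtain ⟨C, hC⟩ := hb _ hA'
  have hz : 0 < ‖z‖ + 1 := by positivity
  set R : ℝ := δ / 2 / (‖z‖ + 1) with hR
  have hR0 : 0 < R := by positivity
  refine ⟨C / R, fun x hx => ?_⟩
  have key : ∀ t : ℂ, ‖t‖ ≤ R → dist ((x : E) + t • z) x ≤ δ / 2 := by
    intro t ht
    rw [dist_eq_norm, add_sub_cancel_left, norm_smul]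
    calc ‖t‖ * ‖z‖ ≤ R * (‖z‖ + 1) := by gcongr; linarith
      _ = δ / 2 := by rw [hR]; field_simp
  have hmem : ∀ t : ℂ, ‖t‖ ≤ R → (x : E) + t • z ∈ U := fun t ht =>
    hball x hx (by rw [mem_ball]; linarith [key t ht])
  have hline : ∀ t : ℂ, HasFDerivAt (fun t : ℂ => (x : E) + t • z)
      ((ContinuousLinearMap.id ℂ ℂ).smulRight z) t := fun t =>
    ((ContinuousLinearMap.id ℂ ℂ).smulRight z).hasFDerivAt.const_add (x : E)
  have hdiff : ∀ t : ℂ, ‖t‖ ≤ R →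
      DifferentiableAt ℂ (fun t : ℂ => zeroExt U f ((x : E) + t • z)) t := fun t ht =>
    DifferentiableAt.comp t (ha ⟨_, hmem t ht⟩).differentiableAt (hline t).differentiableAt
  have hder : deriv (fun t : ℂ => zeroExt U f ((x : E) + t • z)) 0 =
      fderiv ℂ (zeroExt U f) x z := by
    have h1 : HasFDerivAt (zeroExt U f) (fderiv ℂ (zeroExt U f) (x : E)) ((x : E) + (0 : ℂ) • z) := by
      simpa using (ha x).differentiableAt.hasFDerivAt
    have h2 := (h1.comp (0 : ℂ) (hline 0)).hasDerivAt.deriv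
    simpa [Function.comp_def] using h2
  change ‖fderiv ℂ (zeroExt U f) (x : E) z‖ ≤ C / R
  rw [← hder]
  refine Complex.norm_deriv_le_of_forall_mem_sphere_norm_le hR0 ?_ ?_
  · refine DifferentiableOn.diffContOnCl fun t ht => (hdiff t ?_).differentiableWithinAt
    have := closure_ball_subset_closedBall ht
    simpa using this
  · intro t ht
    have ht' : ‖t‖ ≤ R := by simpa using sphere_subset_closedBall ht
    have := hC ⟨_, hmem t ht'⟩ ⟨x, hx, key t ht'⟩
    rwa [← zeroExt_apply U f] at this

theorem iteratedFDeriv_mem_hb (U : Opens E) (z : E) {f : U → ℂ} (hf : f ∈ Hb U) (n : ℕ) :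
    (fun y : U => iteratedFDeriv ℂ n (zeroExt U f) (y : E) (fun _ => z)) ∈ Hb U := by
  induction n with
  | zero =>
    have : (fun y : U => iteratedFDeriv ℂ 0 (zeroExt U f) (y : E) (fun _ => z)) = f := by
      funext y
      simp [zeroExt_apply]
    rwa [this]
  | succ n ih =>
    convert fderiv_mem_hb U z ih using 2 with y
    have hU : AnalyticOnNhd ℂ (zeroExt U f) (U : Set E) := fun w hw => hf.1 ⟨w, hw⟩
    have hd : DifferentiableAt ℂ (iteratedFDeriv ℂ n (zeroExt U f)) (y : E) :=
      (hU.iteratedFDeriv n y y.2).differentiableAt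
    have e := zeroExt_eventuallyEq (U := U)
      (f := fun y : U => iteratedFDeriv ℂ n (zeroExt U f) (y : E) (fun _ => z))
      (g := fun y : E => iteratedFDeriv ℂ n (zeroExt U f) y (fun _ => z)) y (fun _ => rfl)
    rw [← e.fderiv_eq, iteratedFDeriv_succ_apply_left]
    have := (hd.hasFDerivAt.continuousMultilinear_apply_const (fun _ => z)).fderiv
    rw [this]
    rfl

/-- The function `y ↦ dⁿf(y)(z) / n!` on `U`, as an element of `H_b(U)`. -/
def taylorTerm {U : Opens E} (n : ℕ) (z : E) (f : Hb U) : Hb U :=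
  ⟨fun y : U => ((n.factorial : ℂ))⁻¹ *
      iteratedFDeriv ℂ n (zeroExt U (f : U → ℂ)) (y : E) (fun _ => z),
    (Hb U).smul_mem (iteratedFDeriv_mem_hb U z f.2 n) ((n.factorial : ℂ))⁻¹⟩

/-- The restriction to `U` of a continuous linear functional, as an element of `H_b(U)`. -/
def dualRestrict (U : Opens E) (γ : StrongDual ℂ E) : Hb U :=
  ⟨fun x : U => γ x, isHolo_of_eq (g := γ) (fun _ => rfl) fun y => γ.analyticAt y, by
    rintro A ⟨hA, -⟩
    obtain ⟨R, hR⟩ := hA.exists_norm_le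
    refine ⟨‖γ‖ * R, fun x hx => (γ.le_opNorm x).trans ?_⟩
    exact mul_le_mul_of_nonneg_left (hR _ ⟨x, hx, rfl⟩) (norm_nonneg _)⟩

/-! ### The spectrum of `H_b(U)` and its analytic structure -/

/-- The spectrum `M_b(U)`: the continuous unital (equivalently, nonzero) multiplicative linear
functionals on `H_b(U)`. -/
structure Mb (U : Opens E) where
  toAlgHom : Hb U →ₐ[ℂ] ℂ
  continuous_toAlgHom : Continuous[hbTopology U, inferInstance] toAlgHom

instance (U : Opens E) : CoeFun (Mb U) (fun _ => Hb U → ℂ) := ⟨fun φ => φ.toAlgHom⟩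

theorem Mb.exists_bound {U : Opens E} (φ : Mb U) :
    ∃ A : Set U, IsUBounded U A ∧ ∃ C : ℝ, 0 ≤ C ∧
      ∀ (f : Hb U) (M : ℝ), 0 ≤ M → (∀ x ∈ A, ‖(f : U → ℂ) x‖ ≤ M) → ‖φ f‖ ≤ C * M := by
  set 𝔖 : Set (Set U) := {A : Set U | IsUBounded U A} with h𝔖
  have hne : 𝔖.Nonempty := ⟨∅, by simp, 1, one_pos, by simp⟩
  have hdir : DirectedOn (· ⊆ ·) 𝔖 := by
    rintro A ⟨hA, δ, hδ, hA'⟩ B ⟨hB, ε, hε, hB'⟩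
    refine ⟨A ∪ B, ⟨?_, min δ ε, lt_min hδ hε, ?_⟩, Set.subset_union_left,
      Set.subset_union_right⟩
    · rw [Set.image_union]
      exact hA.union hB
    · rintro x (hx | hx)
      · exact (ball_subset_ball (min_le_left _ _)).trans (hA' x hx)
      · exact (ball_subset_ball (min_le_right _ _)).trans (hB' x hx)
  have hbasis := (UniformOnFun.hasBasis_nhds_zero_of_basis (G := ℂ) 𝔖 hne hdir
    Metric.nhds_basis_ball).comap
      (fun f : Hb U => UniformOnFun.ofFun 𝔖 (f : U → ℂ))
  have hc : @ContinuousAt _ _ (hbTopology U) _ φ.toAlgHom 0 :=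
    @Continuous.continuousAt _ _ (hbTopology U) _ _ _ φ.continuous_toAlgHom
  have hpre : φ.toAlgHom ⁻¹' ball 0 1 ∈ @nhds _ (hbTopology U) 0 :=
    hc (by rw [map_zero]; exact ball_mem_nhds _ one_pos)
  have hn : @nhds _ (hbTopology U) 0 = comap (fun f : Hb U => UniformOnFun.ofFun 𝔖 (f : U → ℂ))
      (𝓝 0) := nhds_induced _ _
  rw [hn, hbasis.mem_iff] at hpre
  obtain ⟨⟨A, ε⟩, ⟨hA, hε⟩, hsub⟩ := hpre
  simp only at hA hε hsub
  refine ⟨A, hA, 2 / ε, by positivity, fun f M hM hf => ?_⟩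
  have hstep : ∀ N : ℝ, M < N → ‖φ f‖ ≤ 2 / ε * N := by
    intro N hN
    have hN0 : 0 < N := hM.trans_lt hN
    have hmem : (((ε / (2 * N) : ℝ) : ℂ) • f) ∈ φ.toAlgHom ⁻¹' ball 0 1 := by
      refine hsub fun x hx => ?_
      change (((ε / (2 * N) : ℝ) : ℂ) • (f : U → ℂ)) x ∈ ball (0 : ℂ) ε
      rw [mem_ball_zero_iff, Pi.smul_apply, norm_smul, Complex.norm_real,
        Real.norm_of_nonneg (by positivity)]
      calc ε / (2 * N) * ‖(f : U → ℂ) x‖ ≤ ε / (2 * N) * N := by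
            gcongr
            exact (hf x hx).trans hN.le
        _ = ε / 2 := by field_simp
        _ < ε := by linarith
    rw [Set.mem_preimage, mem_ball_zero_iff, map_smul, norm_smul, Complex.norm_real,
      Real.norm_of_nonneg (by positivity)] at hmem
    calc ‖φ f‖ = ε / (2 * N) * ‖φ.toAlgHom f‖ * (2 * N / ε) := by field_simp
      _ ≤ 1 * (2 * N / ε) := by gcongr
      _ = 2 / ε * N := by ring
  have hlim : Tendsto (fun N : ℝ => 2 / ε * N) (𝓝[>] M) (𝓝 (2 / ε * M)) :=
    ((continuous_const.mul continuous_id).tendsto M).mono_left nhdsWithin_le_nhds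
  exact ge_of_tendsto hlim (eventually_nhdsWithin_of_forall hstep)

/-- The Gelfand transform of `f`, that is, the canonical extension of `f ∈ H_b(U)` to `M_b(U)`
through the point evaluations. -/
def gelfand {U : Opens E} (f : Hb U) (φ : Mb U) : ℂ := φ f

/-- `ψ = φ^z`, where `φ^z(f) = ∑ₙ φ(y ↦ dⁿf(y)(z) / n!)`. -/
def IsTranslate {U : Opens E} (φ : Mb U) (z : E) (ψ : Mb U) : Prop :=
  ∀ f : Hb U, HasSum (fun n : ℕ => φ (taylorTerm n z f)) (ψ f)

/-- The topology of `M_b(U)` given by the sections `z ↦ φ^z`: the sets `{φ^z : ‖z‖ < δ}`, with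
`δ > 0` small, form a base of neighbourhoods of `φ`. -/
instance (U : Opens E) : TopologicalSpace (Mb U) where
  IsOpen S := ∀ φ ∈ S, ∃ δ : ℝ, 0 < δ ∧
    ∀ (z : E) (ψ : Mb U), ‖z‖ < δ → IsTranslate φ z ψ → ψ ∈ S
  isOpen_univ := fun _ _ => ⟨1, one_pos, fun _ _ _ _ => Set.mem_univ _⟩
  isOpen_inter := by
    rintro S T hS hT φ ⟨h1, h2⟩
    obtain ⟨δ, hδ, hS'⟩ := hS φ h1
    obtain ⟨ε, hε, hT'⟩ := hT φ h2
    exact ⟨min δ ε, lt_min hδ hε, fun z ψ hz h =>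
      ⟨hS' z ψ (hz.trans_le (min_le_left _ _)) h, hT' z ψ (hz.trans_le (min_le_right _ _)) h⟩⟩
  isOpen_sUnion := by
    rintro 𝒮 h φ ⟨S, hS, hφ⟩
    obtain ⟨δ, hδ, hS'⟩ := h S hS φ hφ
    exact ⟨δ, hδ, fun z ψ hz ht => ⟨S, hS, hS' z ψ hz ht⟩⟩

/-- The projection `π : M_b(U) → E''`, `π(φ)(γ) = φ(γ|_U)`. -/
def bidualProj {U : Opens E} (φ : Mb U) : StrongDual ℂ (StrongDual ℂ E) :=
  LinearMap.mkContinuousOfExistsBound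
    { toFun := fun γ => φ (dualRestrict U γ)
      map_add' := fun γ γ' => map_add φ.toAlgHom (dualRestrict U γ) (dualRestrict U γ')
      map_smul' := fun c γ => map_smul φ.toAlgHom c (dualRestrict U γ) } <| by
    obtain ⟨A, ⟨hA, -⟩, C, hC, h⟩ := φ.exists_bound
    obtain ⟨R, hR⟩ := hA.exists_norm_le
    refine ⟨C * max R 0, fun γ => ?_⟩
    refine (h (dualRestrict U γ) (‖γ‖ * max R 0) (by positivity) fun x hx => ?_).trans
      (le_of_eq (by ring))
    exact (γ.le_opNorm x).trans (mul_le_mul_of_nonneg_left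
      ((hR _ ⟨x, hx, rfl⟩).trans (le_max_left _ _)) (norm_nonneg _))

/-- The projection `π` read as a map into `E`, through the canonical embedding `E → E''`
(meaningful at those `φ` for which `π(φ)` lies in the image of `E`). -/
def proj {U : Opens E} (φ : Mb U) : E :=
  Function.invFun (NormedSpace.inclusionInDoubleDual ℂ E) (bidualProj φ)

end OpenSet

/-! ### Riemann domains over a Banach space -/

section RiemannDomain

variable {E : Type u} [NormedAddCommGroup E] [NormedSpace ℂ E]

/-- `(X, p)` is a Riemann domain over `E`. -/
structure IsRiemannDomain {X : Type v} [TopologicalSpace X] (p : X → E) : Prop where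
  t2Space : T2Space X
  isLocalHomeomorph : IsLocalHomeomorph p

/-- `f` is holomorphic on the Riemann domain `(X, p)`: around every point it is of the form
`g ∘ p` with `g` holomorphic. -/
def IsHoloOn {X : Type v} [TopologicalSpace X] (p : X → E) (f : X → ℂ) : Prop :=
  ∀ x : X, ∃ g : E → ℂ, AnalyticAt ℂ g (p x) ∧ f =ᶠ[𝓝 x] g ∘ p

/-- `dist_X(x)`: the supremum of the `r > 0` such that `p` maps some neighbourhood of `x`
homeomorphically onto the ball `B(p(x), r)`. -/
def domainDist {X : Type v} [TopologicalSpace X] (p : X → E) (x : X) : ℝ≥0∞ :=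
  ⨆ r ∈ {r : ℝ | 0 < r ∧ ∃ e : OpenPartialHomeomorph X E,
    x ∈ e.source ∧ Set.EqOn e p e.source ∧ e.target = ball (p x) r}, ENNReal.ofReal r

/-- `A` is `X`-bounded: `p(A)` is bounded and `dist_X(A) > 0`. -/
def IsDomainBounded {X : Type v} [TopologicalSpace X] (p : X → E) (A : Set X) : Prop :=
  Bornology.IsBounded (p '' A) ∧ 0 < ⨅ x ∈ A, domainDist p x

/-- `f ∈ H_b(X)` for the Riemann domain `(X, p)`. -/
def IsHbOn {X : Type v} [TopologicalSpace X] (p : X → E) (f : X → ℂ) : Prop :=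
  IsHoloOn p f ∧ ∀ A : Set X, IsDomainBounded p A → ∃ C : ℝ, ∀ x ∈ A, ‖f x‖ ≤ C

/-- Morphisms of Riemann domains `(X, p) → (Y, q)`. -/
def IsMorphism {X : Type v} {Y : Type w} [TopologicalSpace X] [TopologicalSpace Y]
    (p : X → E) (q : Y → E) (τ : X → Y) : Prop :=
  Continuous τ ∧ q ∘ τ = p

/-- The morphism `τ : (X, p) → (Y, q)` is an `H_b`-extension of `X`. -/
def IsHbExtension {X : Type v} {Y : Type w} [TopologicalSpace X] [TopologicalSpace Y]
    (p : X → E) (q : Y → E) (τ : X → Y) : Prop :=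
  IsMorphism p q τ ∧ ∀ f : X → ℂ, IsHbOn p f → ∃! g : Y → ℂ, IsHoloOn q g ∧ g ∘ τ = f

/-- The Riemann domain `(X, p)` is an `H_b`-domain of holomorphy: it coincides with its
`H_b`-envelope of holomorphy, that is, the identity of `X` is an `H_b`-extension through which, by
a morphism `μ` with `μ ∘ ν = id`, every `H_b`-extension `ν : X → Z` factors. -/
def IsHbDomainOfHolomorphy {X : Type v} [TopologicalSpace X] (p : X → E) : Prop :=
  IsRiemannDomain p ∧ IsHbExtension p p id ∧
    ∀ (Z : Type w) [TopologicalSpace Z] (s : Z → E), IsRiemannDomain s →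
      ∀ ν : X → Z, IsHbExtension p s ν → ∃ μ : Z → X, IsMorphism s p μ ∧ μ ∘ ν = id

end RiemannDomain

/-! ### The distinguished spectrum of the unit ball of `ℓ_p` -/

section Lp

/-- The complex Banach space `ℓ_p`. -/
abbrev Ell (p : ℕ) : Type := lp (fun _ : ℕ => ℂ) (p : ℝ≥0∞)

/-- The open unit ball of `ℓ_p`. -/
def unitBall (p : ℕ) [Fact (1 ≤ (p : ℝ≥0∞))] : Opens (Ell p) := ⟨ball 0 1, isOpen_ball⟩

/-- `(x_n)` is a block basis of the unit vector basis of `ℓ_p`: the `x_n` are nonzero and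
`x_n = ∑_{j_n ≤ k < j_{n+1}} α_k e_k` for a strictly increasing sequence `(j_n)`. -/
def IsBlockBasis {p : ℕ} (x : ℕ → Ell p) : Prop :=
  ∃ j : ℕ → ℕ, StrictMono j ∧ ∀ n, x n ≠ 0 ∧ ∀ k, k ∉ Set.Ico (j n) (j (n + 1)) → x n k = 0

/-- `(x_n)` is a block basis in the unit ball with `‖x_n‖ → r ∈ (0,1)`. -/
def IsBlockData {p : ℕ} [Fact (1 ≤ (p : ℝ≥0∞))] (x : ℕ → unitBall p) (r : ℝ) : Prop :=
  IsBlockBasis (fun n => (x n : Ell p)) ∧ 0 < r ∧ r < 1 ∧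
    Tendsto (fun n => ‖(x n : Ell p)‖) atTop (𝓝 r)

/-- `φ(f) = lim_Γ f(x_n)` for all `f ∈ H_b(B_{ℓ_p})`. -/
def IsLimitAlong {p : ℕ} [Fact (1 ≤ (p : ℝ≥0∞))] (x : ℕ → unitBall p) (Γ : Ultrafilter ℕ)
    (φ : Mb (unitBall p)) : Prop :=
  ∀ f : Hb (unitBall p), Tendsto (fun n => (f : unitBall p → ℂ) (x n)) Γ (𝓝 (φ f))

/-- `φ` is given by a block basis `(x_n)` in the unit ball with `‖x_n‖ → r ∈ (0,1)` and an
ultrafilter `Γ` on `ℕ` that contains all the sets `{n, n+1, …}`. -/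
def IsBlockLimit {p : ℕ} [Fact (1 ≤ (p : ℝ≥0∞))] (r : ℝ) (φ : Mb (unitBall p)) : Prop :=
  ∃ (x : ℕ → unitBall p) (Γ : Ultrafilter ℕ),
    IsBlockData x r ∧ (∀ n : ℕ, Set.Ici n ∈ Γ) ∧ IsLimitAlong x Γ φ

/-- The distinguished spectrum `M_b^0(B_{ℓ_p})`: the union of the sheets (connected components in
`M_b(B_{ℓ_p})`) of the ultrafilter limits along block bases. -/
def Mb0 (p : ℕ) [Fact (1 ≤ (p : ℝ≥0∞))] : Set (Mb (unitBall p)) :=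
  ⋃ φ ∈ {φ : Mb (unitBall p) | ∃ r : ℝ, IsBlockLimit r φ}, connectedComponent φ

/-- The projection `π` on `M_b^0(B_{ℓ_p})`, with values in `ℓ_p`. -/
def proj0 (p : ℕ) [Fact (1 ≤ (p : ℝ≥0∞))] (φ : Mb0 p) : Ell p := proj φ.1

end Lp

end BoundedType

end

universe w₁

noncomputable section

namespace BoundedType

section Cauchy

variable {E : Type u} [NormedAddCommGroup E] [NormedSpace ℂ E]

theorem hasDerivAt_comp_line {F : Type v} [NormedAddCommGroup F] [NormedSpace ℂ F] {g : E → F}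
    {x z : E} {t : ℂ} (hg : DifferentiableAt ℂ g (x + t • z)) :
    HasDerivAt (fun t : ℂ => g (x + t • z)) (fderiv ℂ g (x + t • z) z) t := by
  have h : HasDerivAt (fun t : ℂ => x + t • z) z t := by
    simpa using ((hasDerivAt_id t).smul_const z).const_add x
  exact hg.hasFDerivAt.comp_hasDerivAt t h

theorem iteratedDeriv_comp_line {g : E → ℂ} {U : Set E} (hU : IsOpen U)
    (hg : AnalyticOnNhd ℂ g U) (x z : E) (n : ℕ) :
    ∀ t : ℂ, x + t • z ∈ U → iteratedDeriv n (fun t : ℂ => g (x + t • z)) t =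
      iteratedFDeriv ℂ n g (x + t • z) (fun _ => z) := by
  induction n with
  | zero => intro t _; simp
  | succ n ih =>
    intro t ht
    have hc : Continuous fun t : ℂ => x + t • z := by fun_prop
    have e : iteratedDeriv n (fun t : ℂ => g (x + t • z)) =ᶠ[𝓝 t]
        fun t => iteratedFDeriv ℂ n g (x + t • z) (fun _ => z) := by
      filter_upwards [(hU.preimage hc).mem_nhds ht] with s hs using ih s hs
    have hd : DifferentiableAt ℂ (iteratedFDeriv ℂ n g) (x + t • z) :=
      (hg.iteratedFDeriv n _ ht).differentiableAt
    rw [iteratedDeriv_succ, e.deriv_eq, iteratedFDeriv_succ_apply_left]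
    have h1 := hasDerivAt_comp_line hd
    have h2 := ((ContinuousMultilinearMap.apply ℂ (fun _ : Fin n => E) ℂ
      (fun _ => z)).hasFDerivAt.comp_hasDerivAt t h1).deriv
    exact h2

/-- Cauchy's estimate for the derivative of a vector-valued function. -/
theorem norm_fderiv_le_of_forall_closedBall {F : Type v} [NormedAddCommGroup F] [NormedSpace ℂ F]
    [CompleteSpace F] {g : E → F} {x : E} {s C : ℝ} (hs : 0 < s)
    (hd : ∀ y ∈ closedBall x s, DifferentiableAt ℂ g y) (hC : ∀ y ∈ closedBall x s, ‖g y‖ ≤ C) :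
    ‖fderiv ℂ g x‖ ≤ C / s := by
  have hC0 : 0 ≤ C := (norm_nonneg _).trans (hC x (mem_closedBall_self hs.le))
  refine ContinuousLinearMap.opNorm_le_bound _ (by positivity) fun z => ?_
  rcases eq_or_ne z 0 with rfl | hz
  · simp
  have hz' : 0 < ‖z‖ := norm_pos_iff.2 hz
  have hmem : ∀ t : ℂ, ‖t‖ ≤ s / ‖z‖ → x + t • z ∈ closedBall x s := by
    intro t ht
    rw [mem_closedBall, dist_eq_norm, add_sub_cancel_left, norm_smul]
    rwa [le_div_iff₀ hz'] at ht
  have key := Complex.norm_deriv_le_of_forall_mem_sphere_norm_le (c := 0)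
    (f := fun t : ℂ => g (x + t • z)) (R := s / ‖z‖) (C := C) (by positivity) ?_ ?_
  · rw [(hasDerivAt_comp_line (t := 0) (by simpa using hd x (mem_closedBall_self hs.le))).deriv]
      at key
    simp only [zero_smul, add_zero] at key
    refine key.trans (le_of_eq ?_)
    field_simp
  · refine DifferentiableOn.diffContOnCl fun t ht => ?_
    have := closure_ball_subset_closedBall ht
    exact (hasDerivAt_comp_line
      (hd _ (hmem t (by simpa using this)))).differentiableAt.differentiableWithinAt
  · intro t ht
    exact hC _ (hmem t (by simpa using sphere_subset_closedBall ht))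

theorem norm_iteratedFDeriv_le_of_forall_closedBall {g : E → ℂ} {U : Set E}
    (hg : AnalyticOnNhd ℂ g U) {s M : ℝ} (hs : 0 < s) (n : ℕ) :
    ∀ x : E, closedBall x (n * s) ⊆ U → (∀ y ∈ closedBall x (n * s), ‖g y‖ ≤ M) →
      ‖iteratedFDeriv ℂ n g x‖ ≤ M / s ^ n := by
  induction n with
  | zero =>
    intro x _ hM
    simpa using hM x (by simp)
  | succ n ih =>
    intro x hx hM
    have hsub : ∀ y ∈ closedBall x s, closedBall y (n * s) ⊆ closedBall x ((n + 1 : ℕ) * s) := by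
      intro y hy
      refine closedBall_subset_closedBall' ?_
      rw [mem_closedBall] at hy
      push_cast
      linarith
    rw [← norm_fderiv_iteratedFDeriv, pow_succ, ← div_div]
    refine norm_fderiv_le_of_forall_closedBall hs (fun y hy => ?_) fun y hy => ?_
    · refine (hg.iteratedFDeriv n y (hx (hsub y hy ?_))).differentiableAt
      exact mem_closedBall_self (by positivity)
    · exact ih y ((hsub y hy).trans hx) fun w hw => hM w (hsub y hy hw)

variable {U : Opens E}

theorem analyticOnNhd_zeroExt (f : Hb U) : AnalyticOnNhd ℂ (zeroExt U (f : U → ℂ)) (U : Set E) :=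
  fun x hx => f.2.1 ⟨x, hx⟩

theorem taylorTerm_apply (n : ℕ) (z : E) (f : Hb U) (y : U) :
    (taylorTerm n z f : U → ℂ) y = ((n.factorial : ℂ))⁻¹ *
      iteratedDeriv n (fun t : ℂ => zeroExt U (f : U → ℂ) ((y : E) + t • z)) 0 := by
  rw [iteratedDeriv_comp_line U.isOpen (analyticOnNhd_zeroExt f) (y : E) z n 0 (by simp)]
  simp [taylorTerm]

theorem taylorTerm_zero (z : E) (f : Hb U) : taylorTerm 0 z f = f := by
  ext y
  rw [taylorTerm_apply]
  simp [zeroExt_apply]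

theorem taylorTerm_taylorTerm (n j : ℕ) (z : E) (f : Hb U) :
    taylorTerm n z (taylorTerm j z f) = ((n + j).choose j : ℂ) • taylorTerm (n + j) z f := by
  ext y
  have hc : Continuous fun t : ℂ => (y : E) + t • z := by fun_prop
  have e : (fun t : ℂ => zeroExt U (taylorTerm j z f : U → ℂ) ((y : E) + t • z)) =ᶠ[𝓝 0]
      fun t : ℂ => ((j.factorial : ℂ))⁻¹ *
        iteratedDeriv j (fun t : ℂ => zeroExt U (f : U → ℂ) ((y : E) + t • z)) t := by
    filter_upwards [(U.isOpen.preimage hc).mem_nhds (by simp : (0 : ℂ) ∈ _)] with t ht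
    rw [iteratedDeriv_comp_line U.isOpen (analyticOnNhd_zeroExt f) (y : E) z j t ht]
    exact zeroExt_apply U (taylorTerm j z f : U → ℂ) ⟨_, ht⟩
  change _ = ((n + j).choose j : ℂ) * (taylorTerm (n + j) z f : U → ℂ) y
  rw [taylorTerm_apply, taylorTerm_apply, e.iteratedDeriv_eq, iteratedDeriv_const_mul_field]
  simp only [iteratedDeriv_eq_iterate, Function.iterate_add_apply]
  have h := Nat.add_choose_mul_factorial_mul_factorial n j
  have h' : ((n + j).choose j : ℂ) * n.factorial * j.factorial = (n + j).factorial := by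
    exact_mod_cast h
  rw [← h']
  have := Nat.cast_ne_zero (R := ℂ).2 n.factorial_ne_zero
  have := Nat.cast_ne_zero (R := ℂ).2 j.factorial_ne_zero
  have : ((n + j).choose j : ℂ) ≠ 0 :=
    Nat.cast_ne_zero.2 (Nat.choose_pos (Nat.le_add_left j n)).ne'
  field_simp

theorem add_smul_mem_closedBall {x z : E} {δ η : ℝ} (hη : 0 < η) (hz : ‖z‖ ≤ η)
    {t : ℂ} (ht : ‖t‖ ≤ δ / η) : x + t • z ∈ closedBall x δ := by
  rw [mem_closedBall, dist_eq_norm, add_sub_cancel_left, norm_smul]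
  rw [le_div_iff₀ hη] at ht
  exact (mul_le_mul_of_nonneg_left hz (norm_nonneg t)).trans ht

theorem norm_taylorTerm_le (f : Hb U) {x : U} {z : E} {δ η M : ℝ} (hδ : 0 < δ) (hη : 0 < η)
    (hz : ‖z‖ ≤ η) (hU : closedBall (x : E) δ ⊆ U)
    (hM : ∀ y : U, dist (y : E) x ≤ δ → ‖(f : U → ℂ) y‖ ≤ M) (n : ℕ) :
    ‖(taylorTerm n z f : U → ℂ) x‖ ≤ M * (η / δ) ^ n := by
  have key := Complex.norm_iteratedDeriv_le_of_forall_mem_sphere_norm_le (c := 0) n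
    (f := fun t : ℂ => zeroExt U (f : U → ℂ) ((x : E) + t • z)) (R := δ / η) (C := M)
    (by positivity) ?_ ?_
  · rw [taylorTerm_apply, norm_mul, norm_inv, Complex.norm_natCast]
    have : (0 : ℝ) < n.factorial := by positivity
    rw [inv_mul_le_iff₀ this]
    refine key.trans (le_of_eq ?_)
    rw [← inv_div δ η, inv_pow]
    ring
  · refine DifferentiableOn.diffContOnCl fun t ht => ?_
    have := closure_ball_subset_closedBall ht
    exact (hasDerivAt_comp_line ((analyticOnNhd_zeroExt f) _ (hU (add_smul_mem_closedBall hη hz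
      (by simpa using this)))).differentiableAt).differentiableAt.differentiableWithinAt
  · intro t ht
    have := add_smul_mem_closedBall (x := (x : E)) (δ := δ) hη hz (t := t)
      (by simpa using sphere_subset_closedBall ht)
    rw [zeroExt_apply U (f : U → ℂ) ⟨_, hU this⟩]
    exact hM _ this

theorem hasSum_taylorTerm (f : Hb U) {x : U} {z : E} {δ : ℝ} (hz : ‖z‖ < δ)
    (hU : closedBall (x : E) δ ⊆ U) (hxz : (x : E) + z ∈ U) :
    HasSum (fun n => (taylorTerm n z f : U → ℂ) x) ((f : U → ℂ) ⟨x + z, hxz⟩) := by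
  obtain ⟨η, hη1, hη2⟩ := exists_between hz
  have hη : 0 < η := (norm_nonneg z).trans_lt hη1
  have h1 : (1 : ℂ) ∈ ball (0 : ℂ) (δ / η) := by
    simpa using (one_lt_div hη).2 hη2
  have key := Complex.hasSum_taylorSeries_on_ball (c := 0) (r := δ / η)
    (f := fun t : ℂ => zeroExt U (f : U → ℂ) ((x : E) + t • z)) (fun t ht => ?_) h1
  · have e : (f : U → ℂ) ⟨x + z, hxz⟩ = zeroExt U (f : U → ℂ) ((x : E) + (1 : ℂ) • z) := by
      rw [one_smul]
      exact (zeroExt_apply U (f : U → ℂ) ⟨_, hxz⟩).symm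
    rw [e]
    refine key.congr_fun fun n => ?_
    rw [taylorTerm_apply]
    simp
  · exact (hasDerivAt_comp_line ((analyticOnNhd_zeroExt f) _ (hU (add_smul_mem_closedBall hη hη1.le
      (by simpa using
        (mem_ball.1 ht).le)))).differentiableAt).differentiableAt.differentiableWithinAt

end Cauchy

section Spectrum

variable {E : Type u} [NormedAddCommGroup E] [NormedSpace ℂ E] {U : Opens E}

@[ext]
theorem Mb.ext {φ ψ : Mb U} (h : ∀ f, φ f = ψ f) : φ = ψ := by
  cases φ
  cases ψ
  congr
  exact AlgHom.ext h

theorem continuous_of_norm_le (φ : Hb U →ₐ[ℂ] ℂ) {A : Set U} (hA : IsUBounded U A)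
    (h : ∀ (f : Hb U) (M : ℝ), 0 ≤ M → (∀ x ∈ A, ‖(f : U → ℂ) x‖ ≤ M) → ‖φ f‖ ≤ M) :
    Continuous[hbTopology U, inferInstance] φ := by
  let _ := hbTopology U
  refine continuous_iff_continuousAt.2 fun f => Metric.tendsto_nhds.2 fun ε hε => ?_
  have h1 := UniformOnFun.gen_mem_nhds ℂ {A : Set U | IsUBounded U A}
    (UniformOnFun.ofFun {A : Set U | IsUBounded U A} (f : U → ℂ)) hA
    (Metric.dist_mem_uniformity (half_pos hε))
  have h2 : Tendsto (fun f : Hb U => UniformOnFun.ofFun {A : Set U | IsUBounded U A} (f : U → ℂ))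
      (𝓝 f) (𝓝 (UniformOnFun.ofFun {A : Set U | IsUBounded U A} (f : U → ℂ))) :=
    continuous_induced_dom.tendsto f
  filter_upwards [h2 h1] with g hg
  rw [dist_comm, dist_eq_norm, ← map_sub]
  refine (h (f - g) (ε / 2) (half_pos hε).le fun x hx => ?_).trans_lt (half_lt_self hε)
  have := hg x hx
  rw [dist_eq_norm] at this
  exact this.le

/-- `φ` is dominated by the supremum over `A`. -/
def Mb.IsSupportedBy (φ : Mb U) (A : Set U) : Prop :=
  ∀ (f : Hb U) (M : ℝ), 0 ≤ M → (∀ x ∈ A, ‖(f : U → ℂ) x‖ ≤ M) → ‖φ f‖ ≤ M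

/-- A multiplicative functional dominated by a multiple of a supremum is dominated by the
supremum. -/
theorem Mb.isSupportedBy_of_norm_le_mul {φ : Mb U} {A : Set U} {C : ℝ}
    (h : ∀ (f : Hb U) (M : ℝ), 0 ≤ M → (∀ x ∈ A, ‖(f : U → ℂ) x‖ ≤ M) → ‖φ f‖ ≤ C * M) :
    φ.IsSupportedBy A := by
  intro f M hM hf
  by_contra! hlt
  have ha : 0 < ‖φ f‖ := hM.trans_lt hlt
  have hpow : ∀ n : ℕ, 1 ≤ C * (M / ‖φ f‖) ^ n := by
    intro n
    have := h (f ^ n) (M ^ n) (by positivity) fun x hx => by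
      change ‖((f : U → ℂ) x) ^ n‖ ≤ M ^ n
      rw [norm_pow]
      exact pow_le_pow_left₀ (norm_nonneg _) (hf x hx) n
    rw [map_pow, norm_pow] at this
    rw [div_pow, ← mul_div_assoc, le_div_iff₀ (by positivity), one_mul]
    exact this
  have hlim := (tendsto_pow_atTop_nhds_zero_of_lt_one (r := M / ‖φ f‖) (by positivity)
    ((div_lt_one ha).2 hlt)).const_mul C
  have := ge_of_tendsto' hlim hpow
  norm_num at this

theorem Mb.exists_isSupportedBy (φ : Mb U) : ∃ A, IsUBounded U A ∧ φ.IsSupportedBy A := by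
  obtain ⟨A, hA, C, -, h⟩ := φ.exists_bound
  exact ⟨A, hA, isSupportedBy_of_norm_le_mul h⟩

theorem IsUBounded.exists_closedBall {A : Set U} (hA : IsUBounded U A) :
    ∃ δ : ℝ, 0 < δ ∧ (∀ x ∈ A, closedBall (x : E) δ ⊆ (U : Set E)) ∧
      IsUBounded U {y : U | ∃ x ∈ A, dist (y : E) x ≤ δ} := by
  obtain ⟨δ, hδ, h1, h2⟩ := hA.enlarge
  exact ⟨δ / 2, half_pos hδ, fun x hx => (closedBall_subset_ball (half_lt_self hδ)).trans (h1 x hx),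
    h2⟩

theorem Mb.norm_taylorTerm_le {φ : Mb U} {A : Set U} (hφ : φ.IsSupportedBy A) {δ η M : ℝ}
    (hδ : 0 < δ) (hη : 0 < η) (hA : ∀ x ∈ A, closedBall (x : E) δ ⊆ (U : Set E)) (hM0 : 0 ≤ M)
    (f : Hb U) (hM : ∀ y ∈ {y : U | ∃ x ∈ A, dist (y : E) x ≤ δ}, ‖(f : U → ℂ) y‖ ≤ M)
    {z : E} (hz : ‖z‖ ≤ η) (n : ℕ) : ‖φ (taylorTerm n z f)‖ ≤ M * (η / δ) ^ n :=
  hφ _ _ (by positivity) fun x hx =>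
    BoundedType.norm_taylorTerm_le f hδ hη hz (hA x hx) (fun y hy => hM y ⟨x, hx, hy⟩) n

theorem Mb.exists_norm_taylorTerm_le (φ : Mb U) : ∃ δ : ℝ, 0 < δ ∧ ∀ f : Hb U, ∃ M : ℝ, 0 ≤ M ∧
    ∀ (z : E) (η : ℝ), 0 < η → ‖z‖ ≤ η → ∀ n, ‖φ (taylorTerm n z f)‖ ≤ M * (η / δ) ^ n := by
  obtain ⟨A, hA, hφ⟩ := φ.exists_isSupportedBy
  obtain ⟨δ, hδ, h1, h2⟩ := hA.exists_closedBall
  refine ⟨δ, hδ, fun f => ?_⟩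
  obtain ⟨M, hM⟩ := f.2.2 _ h2
  exact ⟨max M 0, le_max_right _ _, fun z η hη hz n => Mb.norm_taylorTerm_le hφ hδ hη h1
    (le_max_right _ _) f (fun y hy => (hM y hy).trans (le_max_left _ _)) hz n⟩

theorem IsTranslate.unique {φ ψ ψ' : Mb U} {z : E} (h : IsTranslate φ z ψ)
    (h' : IsTranslate φ z ψ') : ψ = ψ' :=
  Mb.ext fun f => (h f).unique (h' f)

theorem IsTranslate.isSupportedBy {φ ψ : Mb U} {A : Set U} (hφ : φ.IsSupportedBy A) {δ : ℝ}
    (hδ : 0 < δ) (hA : ∀ x ∈ A, closedBall (x : E) δ ⊆ (U : Set E)) {z : E} (hz : ‖z‖ ≤ δ / 2)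
    (h : IsTranslate φ z ψ) : ψ.IsSupportedBy {y : U | ∃ x ∈ A, dist (y : E) x ≤ δ} := by
  refine Mb.isSupportedBy_of_norm_le_mul (C := 2) fun f M hM0 hM => ?_
  rw [← (h f).tsum_eq]
  have hs := hasSum_geometric_two.mul_left M
  rw [mul_comm]
  refine tsum_of_norm_bounded hs fun n => ?_
  refine (Mb.norm_taylorTerm_le hφ hδ (half_pos hδ) hA hM0 f hM hz n).trans (le_of_eq ?_)
  congr 2
  field_simp

/-- A geometrically bounded sequence all of whose binomially weighted tails vanish. -/
theorem eq_zero_of_hasSum_choose_mul {b : ℕ → ℂ} {M : ℝ}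
    (hb : ∀ N, ‖b N‖ ≤ M * (1 / 4) ^ N)
    (h : ∀ j, HasSum (fun n => ((n + j).choose j : ℂ) * b (n + j)) 0) : b 0 = 0 := by
  set F : ℕ × ℕ → ℂ := fun q => (-1) ^ q.1 * (((q.2 + q.1).choose q.1 : ℂ) * b (q.2 + q.1)) with hF
  have hM : 0 ≤ M := by simpa using (norm_nonneg _).trans (hb 0)
  have hs : Summable F := by
    refine Summable.of_norm_bounded (g := fun q : ℕ × ℕ => M * ((1 / 2) ^ q.1 * (1 / 2) ^ q.2))
      (Summable.mul_left M (summable_geometric_two.mul_of_nonneg summable_geometric_two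
        (fun _ => by positivity) fun _ => by positivity)) fun q => ?_
    rw [hF, norm_mul, norm_mul, norm_pow, norm_neg, norm_one, one_pow, one_mul,
      Complex.norm_natCast]
    have h1 : ((q.2 + q.1).choose q.1 : ℝ) ≤ 2 ^ (q.2 + q.1) := by
      exact_mod_cast Nat.choose_le_two_pow _ _
    calc ((q.2 + q.1).choose q.1 : ℝ) * ‖b (q.2 + q.1)‖
        ≤ 2 ^ (q.2 + q.1) * (M * (1 / 4) ^ (q.2 + q.1)) := by gcongr; exact hb _
      _ = M * ((2 * (1 / 4)) ^ (q.2 + q.1)) := by rw [mul_pow]; ring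
      _ = M * ((1 / 2) ^ q.1 * (1 / 2) ^ q.2) := by
        rw [show (2 * (1 / 4) : ℝ) = 1 / 2 by norm_num, pow_add]
        ring
  have h0 : ∑' q, F q = 0 := by
    rw [hs.tsum_prod]
    refine (tsum_congr fun j => ?_).trans tsum_zero
    simpa using ((h j).mul_left ((-1) ^ j)).tsum_eq
  have h1 : HasSum (fun N => ∑ q ∈ Finset.HasAntidiagonal.antidiagonal N, F q) (∑' q, F q) := by
    have := (Finset.HasAntidiagonal.sigmaAntidiagonalEquivProd (A := ℕ)).hasSum_iff.2 hs.hasSum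
    refine this.sigma fun N => ?_
    have := hasSum_fintype fun q : Finset.HasAntidiagonal.antidiagonal N => F q
    rwa [Finset.sum_coe_sort (Finset.HasAntidiagonal.antidiagonal N) F] at this
  have h2 : ∀ N, ∑ q ∈ Finset.HasAntidiagonal.antidiagonal N, F q = if N = 0 then b 0 else 0 := by
    intro N
    have e : ∀ q ∈ Finset.HasAntidiagonal.antidiagonal N, F q = (-1) ^ q.1 * (N.choose q.1 : ℂ) * b N := by
      intro q hq
      rw [Finset.HasAntidiagonal.mem_antidiagonal, add_comm] at hq
      simp only [hF, hq, mul_assoc]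
    rw [Finset.sum_congr rfl e, ← Finset.sum_mul, Finset.Nat.sum_antidiagonal_eq_sum_range_succ
      (fun i _ => (-1 : ℂ) ^ i * (N.choose i : ℂ))]
    have := congrArg (Int.cast : ℤ → ℂ) (Int.alternating_sum_range_choose (n := N))
    push_cast at this
    rw [this]
    split_ifs with hN
    · rw [hN, one_mul]
    · rw [zero_mul]
  rw [funext h2, h0] at h1
  exact (hasSum_ite_eq 0 (b 0)).unique h1

/-- Small translations of points of the spectrum are injective. -/
theorem Mb.exists_eq_of_isTranslate (φ₁ φ₂ : Mb U) : ∃ ε : ℝ, 0 < ε ∧ ∀ (z : E) (ψ : Mb U),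
    ‖z‖ < ε → IsTranslate φ₁ z ψ → IsTranslate φ₂ z ψ → φ₁ = φ₂ := by
  obtain ⟨δ₁, hδ₁, h₁⟩ := φ₁.exists_norm_taylorTerm_le
  obtain ⟨δ₂, hδ₂, h₂⟩ := φ₂.exists_norm_taylorTerm_le
  refine ⟨min δ₁ δ₂ / 4, by positivity, fun z ψ hz ht₁ ht₂ => Mb.ext fun f => ?_⟩
  obtain ⟨M₁, hM₁, hb₁⟩ := h₁ f
  obtain ⟨M₂, hM₂, hb₂⟩ := h₂ f
  have hz₁ : ‖z‖ ≤ δ₁ / 4 := hz.le.trans (by gcongr; exact min_le_left _ _)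
  have hz₂ : ‖z‖ ≤ δ₂ / 4 := hz.le.trans (by gcongr; exact min_le_right _ _)
  have key := eq_zero_of_hasSum_choose_mul (M := M₁ + M₂)
    (b := fun n => φ₁ (taylorTerm n z f) - φ₂ (taylorTerm n z f)) (fun N => ?_) fun j => ?_
  · simpa [taylorTerm_zero, sub_eq_zero] using key
  · refine (norm_sub_le _ _).trans ?_
    rw [add_mul]
    have e₁ : δ₁ / 4 / δ₁ = 1 / 4 := by field_simp
    have e₂ : δ₂ / 4 / δ₂ = 1 / 4 := by field_simp
    have b₁ := hb₁ z (δ₁ / 4) (by positivity) hz₁ N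
    have b₂ := hb₂ z (δ₂ / 4) (by positivity) hz₂ N
    rw [e₁] at b₁
    rw [e₂] at b₂
    exact add_le_add b₁ b₂
  · have := (ht₁ (taylorTerm j z f)).sub (ht₂ (taylorTerm j z f))
    rw [sub_self] at this
    refine this.congr_fun fun n => ?_
    simp only [taylorTerm_taylorTerm, map_smul, smul_eq_mul, mul_sub]

theorem taylorTerm_dualRestrict_one (γ : StrongDual ℂ E) (z : E) :
    taylorTerm 1 z (dualRestrict U γ) = algebraMap ℂ (Hb U) (γ z) := by
  ext y
  have e := zeroExt_eventuallyEq (U := U) (f := (dualRestrict U γ : U → ℂ)) (g := γ) y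
    fun _ => rfl
  change ((Nat.factorial 1 : ℂ))⁻¹ *
    iteratedFDeriv ℂ 1 (zeroExt U (dualRestrict U γ : U → ℂ)) (y : E) (fun _ => z) = γ z
  rw [iteratedFDeriv_one_apply, ← e.fderiv_eq]
  simp

theorem taylorTerm_dualRestrict_add_two (γ : StrongDual ℂ E) (z : E) (n : ℕ) :
    taylorTerm (n + 2) z (dualRestrict U γ) = 0 := by
  have h := taylorTerm_taylorTerm (n + 1) 1 z (dualRestrict U γ)
  have h0 : taylorTerm (n + 1) z (taylorTerm 1 z (dualRestrict U γ)) = 0 := by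
    rw [taylorTerm_dualRestrict_one]
    ext y
    have e := zeroExt_eventuallyEq (U := U) (f := (algebraMap ℂ (Hb U) (γ z) : U → ℂ))
      (g := fun _ => γ z) y fun _ => rfl
    change ((Nat.factorial (n + 1) : ℂ))⁻¹ * iteratedFDeriv ℂ (n + 1)
      (zeroExt U (algebraMap ℂ (Hb U) (γ z) : U → ℂ)) (y : E) (fun _ => z) = 0
    rw [← (e.iteratedFDeriv ℂ (n + 1)).eq_of_nhds, iteratedFDeriv_const_of_ne (by omega)]
    simp
  rw [h0] at h
  refine (smul_eq_zero.1 h.symm).resolve_left ?_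
  exact Nat.cast_ne_zero.2 (Nat.choose_pos (by omega)).ne'

theorem bidualProj_apply (φ : Mb U) (γ : StrongDual ℂ E) :
    bidualProj φ γ = φ (dualRestrict U γ) := rfl

theorem IsTranslate.bidualProj_eq {φ ψ : Mb U} {z : E} (h : IsTranslate φ z ψ) :
    bidualProj ψ = bidualProj φ + NormedSpace.inclusionInDoubleDual ℂ E z := by
  ext γ
  rw [add_apply, NormedSpace.dual_def, bidualProj_apply, bidualProj_apply]
  have h1 := h (dualRestrict U γ)
  refine h1.unique ?_
  have h2 := hasSum_sum_of_ne_finset_zero (L := .unconditional ℕ) (s := Finset.range 2)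
    (f := fun n => φ (taylorTerm n z (dualRestrict U γ))) fun n hn => by
      obtain ⟨m, rfl⟩ : ∃ m, n = m + 2 := ⟨n - 2, by simp at hn; omega⟩
      rw [taylorTerm_dualRestrict_add_two, map_zero]
  simpa [Finset.sum_range_succ, taylorTerm_zero, taylorTerm_dualRestrict_one] using h2

end Spectrum

section Analytic

variable {E : Type u} [NormedAddCommGroup E] [NormedSpace ℂ E] {U : Opens E}

theorem iteratedFDeriv_apply_mem_hb {f : U → ℂ} (hf : f ∈ Hb U) (n : ℕ) :
    ∀ v : Fin n → E, (fun y : U => iteratedFDeriv ℂ n (zeroExt U f) (y : E) v) ∈ Hb U := by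
  induction n with
  | zero =>
    intro v
    have : (fun y : U => iteratedFDeriv ℂ 0 (zeroExt U f) (y : E) v) = f := by
      funext y
      simp [zeroExt_apply]
    rwa [this]
  | succ n ih =>
    intro v
    convert fderiv_mem_hb U (v 0) (ih (Fin.tail v)) using 2 with y
    have hd : DifferentiableAt ℂ (iteratedFDeriv ℂ n (zeroExt U f)) (y : E) :=
      ((analyticOnNhd_zeroExt ⟨f, hf⟩).iteratedFDeriv n y y.2).differentiableAt
    have e := zeroExt_eventuallyEq (U := U)
      (f := fun y : U => iteratedFDeriv ℂ n (zeroExt U f) (y : E) (Fin.tail v))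
      (g := fun y : E => iteratedFDeriv ℂ n (zeroExt U f) y (Fin.tail v)) y (fun _ => rfl)
    rw [← e.fderiv_eq, iteratedFDeriv_succ_apply_left,
      (hd.hasFDerivAt.continuousMultilinear_apply_const (Fin.tail v)).fderiv]
    rfl

/-- The `H_b(U)`-valued multilinear map `v ↦ (y ↦ Dⁿf(y)(v))`. -/
def iteratedFDerivHb (n : ℕ) (f : Hb U) : MultilinearMap ℂ (fun _ : Fin n => E) (Hb U) where
  toFun v := ⟨_, iteratedFDeriv_apply_mem_hb f.2 n v⟩
  map_update_add' v i x y := by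
    ext z
    exact ContinuousMultilinearMap.map_update_add _ v i x y
  map_update_smul' v i c x := by
    ext z
    exact ContinuousMultilinearMap.map_update_smul _ v i c x

theorem Mb.norm_iteratedFDerivHb_le {φ : Mb U} {A : Set U} (hφ : φ.IsSupportedBy A) {δ M : ℝ}
    (hδ : 0 < δ) (hA : ∀ x ∈ A, closedBall (x : E) δ ⊆ (U : Set E)) (hM0 : 0 ≤ M)
    (f : Hb U) (hM : ∀ y ∈ {y : U | ∃ x ∈ A, dist (y : E) x ≤ δ}, ‖(f : U → ℂ) y‖ ≤ M)
    (n : ℕ) (v : Fin n → E) :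
    ‖φ (iteratedFDerivHb n f v)‖ ≤ M / (δ / (n + 1)) ^ n * ∏ i, ‖v i‖ := by
  refine hφ _ _ (by positivity) fun x hx => ?_
  have hsub : closedBall (x : E) (n * (δ / (n + 1))) ⊆ closedBall (x : E) δ := by
    refine closedBall_subset_closedBall ?_
    rw [← mul_div_assoc, div_le_iff₀ (by positivity)]
    nlinarith
  have h := norm_iteratedFDeriv_le_of_forall_closedBall (analyticOnNhd_zeroExt f)
    (s := δ / (n + 1)) (M := M) (by positivity) n x (hsub.trans (hA x hx)) fun y hy => by
      rw [zeroExt_apply U (f : U → ℂ) ⟨y, hA x hx (hsub hy)⟩]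
      exact hM _ ⟨x, hx, hsub hy⟩
  exact (ContinuousMultilinearMap.le_opNorm _ v).trans (by gcongr)

/-- The translates `φ^w` depend analytically on `w`. -/
theorem Mb.exists_analyticAt_translate (φ : Mb U) (f : Hb U) (a : E) : ∃ g : E → ℂ,
    AnalyticAt ℂ g a ∧ ∀ (w : E) (ψ : Mb U), IsTranslate φ w ψ → g (a + w) = ψ f := by
  obtain ⟨A, hA, hφ⟩ := φ.exists_isSupportedBy
  obtain ⟨δ, hδ, h1, h2⟩ := hA.exists_closedBall
  obtain ⟨M', hM'⟩ := f.2.2 _ h2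
  obtain ⟨M, hM0, hM⟩ : ∃ M : ℝ, 0 ≤ M ∧
      ∀ y ∈ {y : U | ∃ x ∈ A, dist (y : E) x ≤ δ}, ‖(f : U → ℂ) y‖ ≤ M :=
    ⟨max M' 0, le_max_right _ _, fun y hy => (hM' y hy).trans (le_max_left _ _)⟩
  set q : FormalMultilinearSeries ℂ E ℂ := fun n => ((n.factorial : ℂ))⁻¹ •
    (φ.toAlgHom.toLinearMap.compMultilinearMap (iteratedFDerivHb n f)).mkContinuous
      (M / (δ / (n + 1)) ^ n) (Mb.norm_iteratedFDerivHb_le hφ hδ h1 hM0 f hM n) with hq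
  have hqn : ∀ n, ‖q n‖ * (δ / Real.exp 1) ^ n ≤ M * Real.exp 1 := by
    intro n
    have hb : ‖q n‖ ≤ (n.factorial : ℝ)⁻¹ * (M / (δ / (n + 1)) ^ n) := by
      rw [hq, norm_smul, norm_inv, Complex.norm_natCast]
      gcongr
      exact MultilinearMap.mkContinuous_norm_le _ (by positivity) _
    have he := Real.pow_div_factorial_le_exp (n + 1 : ℝ) (by positivity) n
    have he' : Real.exp (n + 1 : ℝ) = Real.exp 1 ^ n * Real.exp 1 := by
      rw [Real.exp_add, ← Real.exp_nat_mul, mul_one]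
    calc ‖q n‖ * (δ / Real.exp 1) ^ n
        ≤ (n.factorial : ℝ)⁻¹ * (M / (δ / (n + 1)) ^ n) * (δ / Real.exp 1) ^ n := by gcongr
      _ = M * ((n + 1 : ℝ) ^ n / n.factorial) / Real.exp 1 ^ n := by
          rw [div_pow, div_pow]
          field_simp
      _ ≤ M * (Real.exp 1 ^ n * Real.exp 1) / Real.exp 1 ^ n := by rw [← he']; gcongr
      _ = M * Real.exp 1 := by field_simp
  have hrad : 0 < q.radius := by
    have hpos : 0 < δ / Real.exp 1 := by positivity
    refine lt_of_lt_of_le ?_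
      (q.le_radius_of_bound (r := ⟨δ / Real.exp 1, hpos.le⟩) (M * Real.exp 1) hqn)
    exact ENNReal.coe_pos.2 hpos
  refine ⟨fun y => q.sum (y - a), ?_, fun w ψ h => ?_⟩
  · have := (q.hasFPowerSeriesOnBall hrad).comp_sub a
    rw [zero_add] at this
    exact this.analyticAt
  · simp only [add_sub_cancel_left, FormalMultilinearSeries.sum]
    rw [← (h f).tsum_eq]
    refine tsum_congr fun n => ?_
    change ((n.factorial : ℂ))⁻¹ • φ.toAlgHom (iteratedFDerivHb n f fun _ => w) = _
    rw [← map_smul]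
    rfl

end Analytic

/-! ### Disjoint unions of balls as Riemann domains -/

section BallUnion

variable {E : Type u} [NormedAddCommGroup E] [NormedSpace ℂ E]

/-- The sections `σ i` exhibit `(X, q)` as the disjoint union, indexed by `ι : X → I`, of the
balls of centre `0` and radius `ρ i`. -/
structure IsBallUnion {X : Type v} [TopologicalSpace X] {I : Type w₁} (q : X → E) (ι : X → I)
    (ρ : I → ℝ) (σ : I → E → X) : Prop where
  continuous_proj : Continuous q
  isLocallyConstant : IsLocallyConstant ι
  norm_lt : ∀ x, ‖q x‖ < ρ (ι x)
  section_proj : ∀ x, σ (ι x) (q x) = x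
  proj_section : ∀ i z, ‖z‖ < ρ i → q (σ i z) = z
  index_section : ∀ i z, ‖z‖ < ρ i → ι (σ i z) = i
  continuousOn_section : ∀ i, ContinuousOn (σ i) (ball 0 (ρ i))

variable {X : Type v} [TopologicalSpace X] {I : Type w₁} {q : X → E} {ι : X → I} {ρ : I → ℝ}
  {σ : I → E → X}

omit [NormedSpace ℂ E] in
theorem IsBallUnion.isRiemannDomain (h : IsBallUnion q ι ρ σ) : IsRiemannDomain q where
  t2Space := by
    let _ : TopologicalSpace I := ⊥
    have : DiscreteTopology I := ⟨rfl⟩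
    refine T2Space.of_injective_continuous (f := fun x => (ι x, q x)) (fun x y hxy => ?_)
      (h.isLocallyConstant.continuous.prodMk h.continuous_proj)
    rw [Prod.mk.injEq] at hxy
    rw [← h.section_proj x, ← h.section_proj y, hxy.1, hxy.2]
  isLocalHomeomorph := by
    refine IsLocalHomeomorph.mk q fun x => ⟨{
      toFun := q
      invFun := σ (ι x)
      source := ι ⁻¹' {ι x}
      target := ball 0 (ρ (ι x))
      map_source' := fun y hy => by
        have := h.norm_lt y
        rw [show ι y = ι x from hy] at this
        simpa using this
      map_target' := fun z hz => h.index_section _ z (by simpa using hz)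
      left_inv' := fun y hy => by
        rw [← show ι y = ι x from hy]
        exact h.section_proj y
      right_inv' := fun z hz => h.proj_section _ z (by simpa using hz)
      continuousOn_toFun := h.continuous_proj.continuousOn
      continuousOn_invFun := h.continuousOn_section _
      open_source := h.isLocallyConstant.isOpen_fiber _
      open_target := isOpen_ball }, rfl, fun _ _ => rfl⟩

theorem norm_add_le_of_ball_subset_ball [Nontrivial E] {a : E} {s t : ℝ} (hs : 0 < s)
    (h : ball a s ⊆ ball 0 t) : ‖a‖ + s ≤ t := by
  obtain ⟨u, hu, hau⟩ : ∃ u : E, ‖u‖ = 1 ∧ a = (‖a‖ : ℂ) • u := by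
    rcases eq_or_ne a 0 with rfl | ha
    · obtain ⟨u, hu⟩ := exists_ne (0 : E)
      exact ⟨((‖u‖ : ℂ))⁻¹ • u, norm_smul_inv_norm hu, by simp⟩
    · refine ⟨((‖a‖ : ℂ))⁻¹ • a, norm_smul_inv_norm ha, ?_⟩
      rw [smul_inv_smul₀]
      simpa using ha
  refine le_of_forall_lt fun c hc => ?_
  set c' := max c ‖a‖ with hc'
  have hlt : c' < ‖a‖ + s := max_lt hc (by linarith)
  have h0 : 0 ≤ c' := (norm_nonneg a).trans (le_max_right _ _)
  have hmem : (c' : ℂ) • u ∈ ball a s := by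
    rw [mem_ball, dist_eq_norm]
    nth_rw 1 [hau]
    rw [← sub_smul, norm_smul, hu, mul_one, ← Complex.ofReal_sub, Complex.norm_real,
      Real.norm_of_nonneg (sub_nonneg.2 (le_max_right _ _))]
    linarith
  have := h hmem
  rw [mem_ball_zero_iff, norm_smul, hu, mul_one, Complex.norm_real, Real.norm_of_nonneg h0] at this
  exact (le_max_left _ _).trans_lt this

theorem IsBallUnion.domainDist_le [Nontrivial E] (h : IsBallUnion q ι ρ σ) (x : X) :
    domainDist q x ≤ ENNReal.ofReal (ρ (ι x) - ‖q x‖) := by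
  refine iSup₂_le fun R hR => ENNReal.ofReal_le_ofReal ?_
  obtain ⟨hR0, e, hx, he, ht⟩ := hR
  have hsub : ball (q x) R ⊆ ball 0 (ρ (ι x)) := by
    intro z hz
    let _ : TopologicalSpace I := ⊥
    have : DiscreteTopology I := ⟨rfl⟩
    have hconst := (convex_ball (q x) R).isPreconnected.constant
      (f := fun z => ι (e.symm z)) (x := z) (y := q x)
      (h.isLocallyConstant.continuous.comp_continuousOn (ht ▸ e.continuousOn_symm)) hz
      (mem_ball_self hR0)
    have hz' : z ∈ e.target := ht ▸ hz
    have h1 : e.symm (q x) = x := by rw [← he hx]; exact e.left_inv hx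
    have h2 : q (e.symm z) = z := by rw [← he (e.map_target hz')]; exact e.right_inv hz'
    have := h.norm_lt (e.symm z)
    rw [h2, hconst, h1] at this
    simpa using this
  linarith [norm_add_le_of_ball_subset_ball hR0 hsub]

theorem IsBallUnion.exists_norm_add_le [Nontrivial E] (h : IsBallUnion q ι ρ σ) {A : Set X}
    (hA : IsDomainBounded q A) : ∃ δ : ℝ, 0 < δ ∧ ∀ x ∈ A, ‖q x‖ + δ ≤ ρ (ι x) := by
  obtain ⟨δ, hδ, hlt⟩ := ENNReal.lt_iff_exists_nnreal_btwn.1 hA.2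
  refine ⟨δ, by exact_mod_cast hδ, fun x hx => ?_⟩
  have h1 := hlt.le.trans ((iInf₂_le x hx).trans (h.domainDist_le x))
  rw [ENNReal.le_ofReal_iff_toReal_le (by simp) (sub_nonneg.2 (h.norm_lt x).le)] at h1
  have : (δ : ℝ) ≤ ρ (ι x) - ‖q x‖ := h1
  linarith

theorem isHoloOn_of_isLocallyConstant {f : X → ℂ} (hf : IsLocallyConstant f) : IsHoloOn q f :=
  fun x => ⟨fun _ => f x, analyticAt_const, (IsLocallyConstant.iff_eventually_eq f).1 hf x⟩

theorem IsHoloOn.mul {f g : X → ℂ} (hf : IsHoloOn q f) (hg : IsHoloOn q g) :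
    IsHoloOn q (f * g) := by
  intro x
  obtain ⟨F, hF, hF'⟩ := hf x
  obtain ⟨G, hG, hG'⟩ := hg x
  exact ⟨F * G, hF.mul hG, hF'.mul hG'⟩

theorem IsHoloOn.comp_proj {g : E → ℂ} (hg : ∀ x, AnalyticAt ℂ g (q x)) : IsHoloOn q (g ∘ q) :=
  fun x => ⟨g, hg x, EventuallyEq.rfl⟩

theorem IsHoloOn.continuous (hq : Continuous q) {f : X → ℂ} (hf : IsHoloOn q f) :
    Continuous f := by
  refine continuous_iff_continuousAt.2 fun x => ?_
  obtain ⟨g, hg, he⟩ := hf x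
  exact (ContinuousAt.comp hg.continuousAt hq.continuousAt).congr he.symm

open Classical in
/-- A disjoint union of balls is an `H_b`-domain of holomorphy. -/
theorem IsBallUnion.isHbDomainOfHolomorphy [Nontrivial E] (h : IsBallUnion q ι ρ σ) :
    IsHbDomainOfHolomorphy.{u, v, w} q := by
  refine ⟨h.isRiemannDomain, ⟨⟨continuous_id, rfl⟩, fun f hf => ⟨f, ⟨hf.1, rfl⟩, fun g hg => hg.2⟩⟩,
    fun Z _ s hs ν hν => ?_⟩
  obtain ⟨⟨hνc, hνs⟩, hext⟩ := hν
  have hsc : Continuous s := hs.isLocalHomeomorph.continuous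
  -- the indicator function of a sheet
  set χ : I → X → ℂ := fun i x => if ι x = i then 1 else 0 with hχ
  have hχlc : ∀ i, IsLocallyConstant (χ i) := fun i =>
    h.isLocallyConstant.comp fun j => if j = i then (1 : ℂ) else 0
  have hχb : ∀ i, IsHbOn q (χ i) := fun i =>
    ⟨isHoloOn_of_isLocallyConstant (hχlc i), fun A _ => ⟨1, fun x _ => by
      simp only [hχ]; split_ifs <;> simp⟩⟩
  choose k hk hk' using fun i => (hext (χ i) (hχb i)).exists
  have huniq : ∀ {f : X → ℂ} (_ : IsHbOn q f) {g g' : Z → ℂ}, IsHoloOn s g → IsHoloOn s g' →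
      g ∘ ν = f → g' ∘ ν = f → g = g' := fun hf _ _ hg hg' e e' =>
    (hext _ hf).unique ⟨hg, e⟩ ⟨hg', e'⟩
  have hk_sq : ∀ i, k i * k i = k i := fun i => by
    refine huniq (hχb i) ((hk i).mul (hk i)) (hk i) ?_ (hk' i)
    rw [Pi.mul_comp, hk']
    funext x
    simp only [hχ, Pi.mul_apply]
    split_ifs <;> simp
  have hk01 : ∀ i z, k i z = 0 ∨ k i z = 1 := fun i z => by
    have := congrFun (hk_sq i) z
    rw [Pi.mul_apply] at this
    rcases eq_or_ne (k i z) 0 with h0 | h0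
    · exact Or.inl h0
    · exact Or.inr (mul_right_cancel₀ h0 (by rw [this, one_mul]))
  have hzero : IsHbOn q (0 : X → ℂ) :=
    ⟨fun x => ⟨0, analyticAt_const, EventuallyEq.rfl⟩, fun A _ => ⟨0, fun x _ => by simp⟩⟩
  have hzero' : IsHoloOn s (0 : Z → ℂ) := fun x => ⟨0, analyticAt_const, EventuallyEq.rfl⟩
  have hk_disj : ∀ i j, i ≠ j → k i * k j = 0 := fun i j hij => by
    refine huniq hzero ((hk i).mul (hk j)) hzero' ?_ rfl
    rw [Pi.mul_comp, hk', hk']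
    funext x
    simp only [hχ, Pi.mul_apply, Pi.zero_apply]
    split_ifs with h1 h2
    · exact absurd (h1.symm.trans h2) hij
    all_goals simp
  have hk_lc : ∀ i, IsLocallyConstant (k i) := fun i => by
    refine (IsLocallyConstant.iff_eventually_eq _).2 fun z => ?_
    filter_upwards [Metric.tendsto_nhds.1 (((hk i).continuous hsc).tendsto z) 1 one_pos] with z' hz'
    rcases hk01 i z with h0 | h0 <;> rcases hk01 i z' with h1 | h1 <;> rw [h0, h1] at hz' ⊢ <;>
      simp at hz'
  -- the extended indicator functions are constant on connected neighbourhoods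
  have hloc : ∀ z : Z, ∃ V ∈ 𝓝 z, ∀ i, ∀ z' ∈ V, k i z' = k i z := by
    intro z
    obtain ⟨e, hze, -⟩ := hs.isLocalHomeomorph z
    obtain ⟨ε, hε, hball⟩ := Metric.isOpen_iff.1 e.open_target (e z) (e.map_source hze)
    refine ⟨e.source ∩ e ⁻¹' ball (e z) ε, (e.isOpen_inter_preimage isOpen_ball).mem_nhds
      ⟨hze, mem_ball_self hε⟩, fun i z' hz' => ?_⟩
    have hpre : IsPreconnected (e.symm '' ball (e z) ε) :=
      (convex_ball _ _).isPreconnected.image _ (e.continuousOn_symm.mono hball)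
    exact (hk_lc i).apply_eq_of_isPreconnected hpre ⟨e z', hz'.2, e.left_inv hz'.1⟩
      ⟨e z, mem_ball_self hε, e.left_inv hze⟩
  have hk_one : ∀ x, k (ι x) (ν x) = 1 := fun x => by
    simpa [hχ] using congrFun (hk' (ι x)) x
  have hcover : ∀ z, ∃ i, k i z = 1 := by
    have hN : IsHoloOn s fun z : Z => if ∃ i, k i z = 1 then (0 : ℂ) else 1 := by
      refine isHoloOn_of_isLocallyConstant ((IsLocallyConstant.iff_eventually_eq _).2 fun z => ?_)
      obtain ⟨V, hV, hVk⟩ := hloc z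
      filter_upwards [hV] with z' hz'
      simp only [hVk _ z' hz']
    have h0 := huniq hzero hN hzero' (funext fun x => if_pos ⟨ι x, hk_one x⟩) rfl
    intro z
    by_contra hz
    simpa [hz] using congrFun h0 z
  choose i hi using hcover
  have hi_eq : ∀ z j, k j z = 1 → i z = j := fun z j hj => by
    by_contra hne
    simpa [hi, hj] using congrFun (hk_disj _ _ hne) z
  have hlt : ∀ z, ‖s z‖ < ρ (i z) := by
    intro z
    by_contra! hge
    obtain ⟨γ, hγ, hγz⟩ := exists_dual_vector'' ℂ (s z)
    set j := i z with hj
    have hbound : ∀ x, ι x = j → ρ j - ‖q x‖ ≤ ‖γ (q x) - γ (s z)‖ := fun x _ => by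
      have h1 : ‖γ (q x)‖ ≤ ‖q x‖ :=
        (γ.le_opNorm _).trans (mul_le_of_le_one_left (norm_nonneg _) hγ)
      have h2 : ‖γ (s z)‖ = ‖s z‖ := by rw [hγz]; simp
      have h3 := norm_sub_norm_le (γ (s z)) (γ (q x))
      rw [norm_sub_rev] at h3
      linarith
    have hpos : ∀ x, ι x = j → 0 < ρ j - ‖q x‖ := fun x hx => by
      have := h.norm_lt x
      rw [hx] at this
      linarith
    set f : X → ℂ := fun x => if ι x = j then (γ (q x) - γ (s z))⁻¹ else 0 with hf
    have hfb : IsHbOn q f := by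
      refine ⟨fun x => ?_, fun A hA => ?_⟩
      · have hx := (IsLocallyConstant.iff_eventually_eq ι).1 h.isLocallyConstant x
        by_cases hxj : ι x = j
        · refine ⟨fun y => (γ y - γ (s z))⁻¹, ((γ.analyticAt _).sub analyticAt_const).inv ?_, ?_⟩
          · exact norm_pos_iff.1 ((hpos x hxj).trans_le (hbound x hxj))
          · filter_upwards [hx] with y hy
            simp only [hf, Function.comp_apply]
            rw [if_pos (hy.trans hxj)]
        · refine ⟨0, analyticAt_const, ?_⟩
          filter_upwards [hx] with y hy
          simp only [hf, Function.comp_apply, Pi.zero_apply]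
          rw [if_neg (by rwa [hy])]
      · obtain ⟨δ, hδ, hA'⟩ := h.exists_norm_add_le hA
        refine ⟨δ⁻¹, fun x hx => ?_⟩
        simp only [hf]
        split_ifs with hxj
        · rw [norm_inv]
          have := hA' x hx
          rw [hxj] at this
          exact inv_anti₀ hδ (by linarith [hbound x hxj])
        · simp [hδ.le]
    obtain ⟨F, hF, hF'⟩ := (hext f hfb).exists
    have hG : IsHoloOn s ((fun y => γ y - γ (s z)) ∘ s) :=
      IsHoloOn.comp_proj fun x => (γ.analyticAt _).sub analyticAt_const
    have heq := huniq (hχb j) (hF.mul hG) (hk j) (by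
      rw [Pi.mul_comp, hF']
      funext x
      have e : s (ν x) = q x := congrFun hνs x
      simp only [hf, hχ, Pi.mul_apply, Function.comp_apply, e]
      split_ifs with hxj
      · exact inv_mul_cancel₀ (norm_pos_iff.1 ((hpos x hxj).trans_le (hbound x hxj)))
      · rw [zero_mul]) (hk' j)
    simpa [hi z, hj] using congrFun heq z
  refine ⟨fun z => σ (i z) (s z), ⟨continuous_iff_continuousAt.2 fun z => ?_, funext fun z =>
    h.proj_section _ _ (hlt z)⟩, funext fun x => ?_⟩
  · obtain ⟨V, hV, hVk⟩ := hloc z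
    have hc : ContinuousAt (fun z' => σ (i z) (s z')) z :=
      ContinuousAt.comp ((h.continuousOn_section (i z)).continuousAt
        (isOpen_ball.mem_nhds (by simpa using hlt z))) hsc.continuousAt
    refine hc.congr ?_
    filter_upwards [hV] with z' hz'
    rw [hi_eq z' (i z) ((hVk _ z' hz').trans (hi z))]
  · have e : s (ν x) = q x := congrFun hνs x
    simp only [Function.comp_apply, e, hi_eq (ν x) (ι x) (hk_one x), h.section_proj, id]

end BallUnion

section SequenceSpace

variable {p : ℕ} [Fact (1 ≤ (p : ℝ≥0∞))]

omit [Fact (1 ≤ (p : ℝ≥0∞))] in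
theorem Ell.hasSum_norm_pow (hp : 0 < p) (x : Ell p) :
    HasSum (fun k => ‖x k‖ ^ p) (‖x‖ ^ p) := by
  have := lp.hasSum_norm (p := (p : ℝ≥0∞)) (by simpa using hp) x
  simpa using this

omit [Fact (1 ≤ (p : ℝ≥0∞))] in
theorem Ell.norm_add_pow (hp : 0 < p) {x y : Ell p} (h : ∀ k, x k = 0 ∨ y k = 0) :
    ‖x + y‖ ^ p = ‖x‖ ^ p + ‖y‖ ^ p := by
  refine (Ell.hasSum_norm_pow hp (x + y)).unique ?_
  refine ((Ell.hasSum_norm_pow hp x).add (Ell.hasSum_norm_pow hp y)).congr_fun fun k => ?_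
  rw [lp.coeFn_add, Pi.add_apply]
  rcases h k with h | h <;> simp [h, hp.ne']

/-- The truncation of a sequence to its first `K` terms. -/
def Ell.trunc (z : Ell p) (K : ℕ) : Ell p := ∑ k ∈ Finset.range K, lp.single p k (z k)

omit [Fact (1 ≤ (p : ℝ≥0∞))] in
theorem Ell.trunc_apply (z : Ell p) (K k : ℕ) :
    Ell.trunc z K k = if k < K then z k else 0 := by
  rw [Ell.trunc, lp.coeFn_sum, Finset.sum_apply]
  simp [Pi.single_apply]

theorem Ell.tendsto_trunc (z : Ell p) : Tendsto (Ell.trunc z) atTop (𝓝 z) :=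
  (lp.hasSum_single (by simp) z).tendsto_sum_nat

omit [Fact (1 ≤ (p : ℝ≥0∞))] in
theorem Ell.norm_trunc_pow_le (hp : 0 < p) (z : Ell p) (K : ℕ) :
    ‖Ell.trunc z K‖ ^ p ≤ ‖z‖ ^ p := by
  refine hasSum_le (fun k => ?_) (Ell.hasSum_norm_pow hp _) (Ell.hasSum_norm_pow hp z)
  rw [Ell.trunc_apply]
  split_ifs
  · exact le_rfl
  · simp [hp.ne']

instance Ell.nontrivial : Nontrivial (Ell p) := by
  refine ⟨lp.single p 0 1, 0, fun h => ?_⟩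
  have := congrArg (fun x : Ell p => x 0) h
  simp at this

omit [Fact (1 ≤ (p : ℝ≥0∞))] in
theorem IsBlockBasis.eventually_eq_zero {x : ℕ → Ell p} (hx : IsBlockBasis x) (K : ℕ) :
    ∀ᶠ n in atTop, ∀ k < K, x n k = 0 := by
  obtain ⟨j, hj, h⟩ := hx
  filter_upwards [eventually_ge_atTop K] with n hn k hk
  refine (h n).2 k fun hmem => ?_
  have := hj.le_apply (x := n)
  have := hmem.1
  omega

omit [Fact (1 ≤ (p : ℝ≥0∞))] in
theorem IsBlockBasis.disjoint {x : ℕ → Ell p} (hx : IsBlockBasis x) {m n : ℕ} (hmn : m ≠ n)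
    (k : ℕ) : x m k = 0 ∨ x n k = 0 := by
  obtain ⟨j, hj, h⟩ := hx
  by_contra! hne
  have hm : k ∈ Set.Ico (j m) (j (m + 1)) := by_contra fun hk => hne.1 ((h m).2 k hk)
  have hn : k ∈ Set.Ico (j n) (j (n + 1)) := by_contra fun hk => hne.2 ((h n).2 k hk)
  rcases hmn.lt_or_gt with hlt | hlt
  · have := hj.monotone (Nat.succ_le_of_lt hlt)
    have := hm.2
    have := hn.1
    simp only [Nat.succ_eq_add_one] at *
    omega
  · have := hj.monotone (Nat.succ_le_of_lt hlt)
    have := hn.2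
    have := hm.1
    simp only [Nat.succ_eq_add_one] at *
    omega

omit [Fact (1 ≤ (p : ℝ≥0∞))] in
theorem IsBlockBasis.norm_sum_smul_pow {x : ℕ → Ell p} (hx : IsBlockBasis x) (hp : 0 < p)
    (c : ℕ → ℂ) (F : Finset ℕ) : ‖∑ n ∈ F, c n • x n‖ ^ p = ∑ n ∈ F, ‖c n • x n‖ ^ p := by
  classical
  induction F using Finset.induction_on with
  | empty => simp [hp.ne']
  | insert m F hm ih =>
    rw [Finset.sum_insert hm, Finset.sum_insert hm, Ell.norm_add_pow hp, ih]
    intro k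
    by_cases hk : x m k = 0
    · left
      simp [hk]
    · right
      simp only [lp.coeFn_sum, Finset.sum_apply, lp.coeFn_smul, Pi.smul_apply]
      refine Finset.sum_eq_zero fun n hn => ?_
      rw [(hx.disjoint (fun h : m = n => hm (h ▸ hn)) k).resolve_left hk, smul_zero]

/-- Bounded block bases of `ℓ_p`, `p > 1`, are weakly null. -/
theorem IsBlockBasis.tendsto_dual {x : ℕ → Ell p} (hx : IsBlockBasis x) (hp : 1 < p)
    (hb : ∀ n, ‖x n‖ ≤ 1) (γ : StrongDual ℂ (Ell p)) :
    Tendsto (fun n => γ (x n)) atTop (𝓝 0) := by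
  rw [Metric.tendsto_atTop']
  by_contra! hcon
  obtain ⟨ε, hε, hcon⟩ := hcon
  simp only [dist_zero_right] at hcon
  have hinf : {n | ε ≤ ‖γ (x n)‖}.Infinite := Set.infinite_of_not_bddAbove fun ⟨N, hN⟩ => by
    obtain ⟨n, hn, hn'⟩ := hcon N
    exact absurd (hN hn') (by omega)
  have key : ∀ N : ℕ, (N : ℝ) * (ε ^ 2) ^ p ≤ (‖γ‖ ^ 2) ^ p := by
    intro N
    rcases Nat.eq_zero_or_pos N with rfl | hN
    · simp
    obtain ⟨F, hF, hcard⟩ := hinf.exists_subset_card_eq N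
    set v : Ell p := ∑ n ∈ F, (starRingEnd ℂ (γ (x n))) • x n with hv
    have hγn : ∀ n, ‖γ (x n)‖ ≤ ‖γ‖ := fun n =>
      (γ.le_opNorm _).trans (mul_le_of_le_one_right (norm_nonneg _) (hb n))
    have hvn : ‖v‖ ^ p ≤ N * ‖γ‖ ^ p := by
      rw [hv, hx.norm_sum_smul_pow (by omega), ← hcard, ← nsmul_eq_mul]
      refine Finset.sum_le_card_nsmul _ _ _ fun n _ => ?_
      rw [norm_smul, RCLike.norm_conj]
      exact pow_le_pow_left₀ (by positivity)
        ((mul_le_of_le_one_right (norm_nonneg _) (hb n)).trans (hγn n)) p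
    have hγv : (N : ℝ) * ε ^ 2 ≤ ‖γ v‖ := by
      have e : γ v = ((∑ n ∈ F, ‖γ (x n)‖ ^ 2 : ℝ) : ℂ) := by
        rw [hv, map_sum, Complex.ofReal_sum]
        refine Finset.sum_congr rfl fun n _ => ?_
        rw [map_smul, smul_eq_mul, mul_comm, Complex.mul_conj, Complex.normSq_eq_norm_sq]
      rw [e, Complex.norm_real, Real.norm_of_nonneg (by positivity), ← hcard, ← nsmul_eq_mul]
      exact Finset.card_nsmul_le_sum _ _ _ fun n hn => pow_le_pow_left₀ hε.le (hF hn) 2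
    have hN' : (0 : ℝ) < N := by exact_mod_cast hN
    have h2 : ((N : ℝ) * ε ^ 2) ^ p ≤ ‖γ‖ ^ p * (N * ‖γ‖ ^ p) := by
      refine (pow_le_pow_left₀ (by positivity) (hγv.trans (γ.le_opNorm v)) p).trans ?_
      rw [mul_pow]
      gcongr
    have h3 : (N : ℝ) ^ 2 ≤ (N : ℝ) ^ p :=
      pow_le_pow_right₀ (by exact_mod_cast hN) (by omega)
    refine le_of_mul_le_mul_left ?_ hN'
    calc (N : ℝ) * (N * (ε ^ 2) ^ p) = (N : ℝ) ^ 2 * (ε ^ 2) ^ p := by ring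
      _ ≤ (N : ℝ) ^ p * (ε ^ 2) ^ p := by gcongr
      _ ≤ ‖γ‖ ^ p * (N * ‖γ‖ ^ p) := by rw [← mul_pow]; exact h2
      _ = N * (‖γ‖ ^ 2) ^ p := by rw [← pow_mul, two_mul, pow_add]; ring
  obtain ⟨N, hN⟩ := exists_nat_gt ((‖γ‖ ^ 2) ^ p / (ε ^ 2) ^ p)
  rw [div_lt_iff₀ (by positivity)] at hN
  exact absurd (key N) (not_le.2 hN)

theorem IsBlockData.eventually_norm_add_trunc {x : ℕ → unitBall p} {r : ℝ}
    (hx : IsBlockData x r) (hp : 0 < p) (z : Ell p) (K : ℕ) :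
    ∀ᶠ n in atTop, ‖(x n : Ell p) + Ell.trunc z K‖ ^ p =
      ‖(x n : Ell p)‖ ^ p + ‖Ell.trunc z K‖ ^ p := by
  filter_upwards [hx.1.eventually_eq_zero K] with n hn
  refine Ell.norm_add_pow hp fun k => ?_
  rw [Ell.trunc_apply]
  split_ifs with hk
  · exact Or.inl (hn k hk)
  · exact Or.inr rfl

theorem IsBlockData.eventually_norm_add_trunc_lt {x : ℕ → unitBall p} {r s : ℝ} {z : Ell p}
    (hx : IsBlockData x r) (hp : 0 < p) (hs : 0 ≤ s) (h : r ^ p + ‖z‖ ^ p < s ^ p) (K : ℕ) :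
    ∀ᶠ n in atTop, ‖(x n : Ell p) + Ell.trunc z K‖ < s := by
  have hlim := (hx.2.2.2.pow p).add_const (‖z‖ ^ p)
  filter_upwards [hx.eventually_norm_add_trunc hp z K, hlim.eventually_lt_const h] with n h1 h2
  refine lt_of_pow_lt_pow_left₀ p hs ?_
  rw [h1]
  linarith [Ell.norm_trunc_pow_le hp z K]

theorem IsBlockData.eventually_norm_add_lt {x : ℕ → unitBall p} {r s : ℝ} {z : Ell p}
    (hx : IsBlockData x r) (hp : 0 < p) (hs : 0 ≤ s) (h : r ^ p + ‖z‖ ^ p < s ^ p) :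
    ∀ᶠ n in atTop, ‖(x n : Ell p) + z‖ < s := by
  have hr : 0 < r := hx.2.1
  obtain ⟨R, hR0, hR⟩ : ∃ R : ℝ, 0 ≤ R ∧ R ^ p = r ^ p + ‖z‖ ^ p :=
    ⟨(r ^ p + ‖z‖ ^ p) ^ ((p : ℝ)⁻¹), by positivity,
      Real.rpow_inv_natCast_pow (by positivity) hp.ne'⟩
  obtain ⟨t, ht1, ht2⟩ := exists_between (lt_of_pow_lt_pow_left₀ p hs (hR.symm ▸ h))
  have ht : r ^ p + ‖z‖ ^ p < t ^ p := hR ▸ pow_lt_pow_left₀ ht1 hR0 hp.ne'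
  obtain ⟨K, hK⟩ := ((Metric.tendsto_nhds.1 (Ell.tendsto_trunc z)) (s - t)
    (sub_pos.2 ht2)).exists
  filter_upwards [hx.eventually_norm_add_trunc_lt hp (hR0.trans ht1.le) ht K] with n hn
  rw [dist_comm, dist_eq_norm] at hK
  calc ‖(x n : Ell p) + z‖ = ‖((x n : Ell p) + Ell.trunc z K) + (z - Ell.trunc z K)‖ := by
        congr 1; abel
    _ ≤ ‖(x n : Ell p) + Ell.trunc z K‖ + ‖z - Ell.trunc z K‖ := norm_add_le _ _
    _ < s := by linarith

/-! #### Diagonal homogeneous polynomials -/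

theorem prod_le_sum_pow_card {n : ℕ} (hn : 0 < n) {a : Fin n → ℝ} (ha : ∀ i, 0 ≤ a i) :
    ∏ i, a i ≤ ∑ i, a i ^ n := by
  have : Nonempty (Fin n) := ⟨⟨0, hn⟩⟩
  obtain ⟨m, -, hm⟩ := Finset.exists_max_image Finset.univ a Finset.univ_nonempty
  calc ∏ i, a i ≤ ∏ _i : Fin n, a m := Finset.prod_le_prod (fun i _ => ha i) hm
    _ = a m ^ n := by simp
    _ ≤ ∑ i, a i ^ n := Finset.single_le_sum (f := fun i => a i ^ n)
        (fun i _ => pow_nonneg (ha i) n) (Finset.mem_univ m)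

omit [Fact (1 ≤ (p : ℝ≥0∞))] in
theorem norm_diag_le (hp : 0 < p) {c : ℕ → ℂ} (hc : ∀ k, ‖c k‖ ≤ 1) (v : Fin p → Ell p) (k : ℕ) :
    ‖c k * ∏ i, v i k‖ ≤ ∑ i, ‖v i k‖ ^ p := by
  rw [norm_mul, norm_prod]
  exact (mul_le_of_le_one_left (Finset.prod_nonneg fun _ _ => norm_nonneg _) (hc k)).trans
    (prod_le_sum_pow_card hp fun _ => norm_nonneg _)

omit [Fact (1 ≤ (p : ℝ≥0∞))] in
theorem hasSum_sum_norm_pow (hp : 0 < p) (v : Fin p → Ell p) :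
    HasSum (fun k => ∑ i, ‖v i k‖ ^ p) (∑ i, ‖v i‖ ^ p) :=
  hasSum_sum fun i _ => Ell.hasSum_norm_pow hp (v i)

omit [Fact (1 ≤ (p : ℝ≥0∞))] in
theorem summable_diag (hp : 0 < p) {c : ℕ → ℂ} (hc : ∀ k, ‖c k‖ ≤ 1) (v : Fin p → Ell p) :
    Summable fun k => c k * ∏ i, v i k :=
  Summable.of_norm_bounded (hasSum_sum_norm_pow hp v).summable (norm_diag_le hp hc v)

omit [Fact (1 ≤ (p : ℝ≥0∞))] in
theorem exists_multilinearMap_prod_coord (k : ℕ) :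
    ∃ m : MultilinearMap ℂ (fun _ : Fin p => Ell p) ℂ, ∀ v, m v = ∏ i, v i k :=
  ⟨(MultilinearMap.mkPiAlgebra ℂ (Fin p) ℂ).compLinearMap fun _ =>
    { toFun := fun x : Ell p => x k, map_add' := fun _ _ => rfl, map_smul' := fun _ _ => rfl },
    fun v => by
      rw [MultilinearMap.compLinearMap_apply, MultilinearMap.mkPiAlgebra_apply]
      rfl⟩

/-- The diagonal `p`-linear form on `ℓ_p` with coefficients `c`, as a multilinear map. -/
def diagMultilinear (hp : 0 < p) {c : ℕ → ℂ} (hc : ∀ k, ‖c k‖ ≤ 1) :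
    MultilinearMap ℂ (fun _ : Fin p => Ell p) ℂ where
  toFun v := ∑' k, c k * ∏ i, v i k
  map_update_add' v i x y := by
    rw [← (summable_diag hp hc _).tsum_add (summable_diag hp hc _)]
    refine tsum_congr fun k => ?_
    obtain ⟨m, hm⟩ := exists_multilinearMap_prod_coord (p := p) k
    rw [← hm, ← hm, ← hm, m.map_update_add, mul_add]
  map_update_smul' v i a x := by
    rw [smul_eq_mul, ← tsum_mul_left]
    refine tsum_congr fun k => ?_
    obtain ⟨m, hm⟩ := exists_multilinearMap_prod_coord (p := p) k
    rw [← hm, ← hm, m.map_update_smul, smul_eq_mul, mul_left_comm]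

theorem norm_diagMultilinear_le (hp : 0 < p) {c : ℕ → ℂ} (hc : ∀ k, ‖c k‖ ≤ 1)
    (v : Fin p → Ell p) : ‖diagMultilinear hp hc v‖ ≤ p * ∏ i, ‖v i‖ := by
  by_cases h0 : ∃ i, v i = 0
  · obtain ⟨i, hi⟩ := h0
    rw [MultilinearMap.map_coord_zero _ i hi, norm_zero]
    positivity
  push Not at h0
  have e : v = fun i => (‖v i‖ : ℂ) • (((‖v i‖ : ℂ))⁻¹ • v i) := by
    funext i
    rw [smul_inv_smul₀]
    simpa only [ne_eq, Complex.ofReal_eq_zero, norm_eq_zero] using h0 i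
  have h1 : ‖diagMultilinear hp hc fun i => ((‖v i‖ : ℂ))⁻¹ • v i‖ ≤ p := by
    refine (tsum_of_norm_bounded (hasSum_sum_norm_pow hp _) (norm_diag_le hp hc _)).trans ?_
    have h2 : ∀ i, ‖((‖v i‖ : ℂ))⁻¹ • v i‖ ^ p = 1 := fun i => by
      have h : ‖((‖v i‖ : ℂ))⁻¹ • v i‖ = 1 := norm_smul_inv_norm (h0 i)
      rw [h, one_pow]
    simp [h2]
  conv_lhs => rw [e]
  rw [MultilinearMap.map_smul_univ, norm_smul, norm_prod, mul_comm]
  have h3 : ∀ i, ‖(‖v i‖ : ℂ)‖ = ‖v i‖ := fun i => by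
    rw [Complex.norm_real, Real.norm_of_nonneg (norm_nonneg _)]
  simp only [h3]
  gcongr

/-- The diagonal `p`-linear form on `ℓ_p` with coefficients `c`. -/
def diagForm (hp : 0 < p) {c : ℕ → ℂ} (hc : ∀ k, ‖c k‖ ≤ 1) :
    ContinuousMultilinearMap ℂ (fun _ : Fin p => Ell p) ℂ :=
  (diagMultilinear hp hc).mkContinuous p (norm_diagMultilinear_le hp hc)

theorem hasSum_diagForm (hp : 0 < p) {c : ℕ → ℂ} (hc : ∀ k, ‖c k‖ ≤ 1) (x : Ell p) :
    HasSum (fun k => c k * x k ^ p) (diagForm hp hc fun _ => x) := by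
  refine (summable_diag hp hc fun _ => x).hasSum.congr_fun fun k => ?_
  simp

theorem norm_diagForm_apply_le (hp : 0 < p) {c : ℕ → ℂ} (hc : ∀ k, ‖c k‖ ≤ 1) (x : Ell p) :
    ‖diagForm hp hc fun _ => x‖ ≤ ‖x‖ ^ p := by
  rw [← (hasSum_diagForm hp hc x).tsum_eq]
  refine tsum_of_norm_bounded (Ell.hasSum_norm_pow hp x) fun k => ?_
  rw [norm_mul, norm_pow]
  exact mul_le_of_le_one_left (by positivity) (hc k)

theorem norm_diagForm_sub_le (hp : 0 < p) {c : ℕ → ℂ} (hc : ∀ k, ‖c k‖ ≤ 1) {x y : Ell p}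
    (hx : ‖x‖ ≤ 1) (hy : ‖y‖ ≤ 1) :
    ‖(diagForm hp hc fun _ => x) - diagForm hp hc fun _ => y‖ ≤ (p : ℝ) ^ 2 * ‖x - y‖ := by
  have : Nonempty (Fin p) := ⟨⟨0, hp⟩⟩
  have h := (diagForm hp hc).norm_image_sub_le (fun _ => x) fun _ => y
  have h1 : ‖diagForm hp hc‖ ≤ p := MultilinearMap.mkContinuous_norm_le _ (by positivity) _
  have e : ((fun _ => x) - fun _ => y : Fin p → Ell p) = fun _ => x - y := rfl
  rw [e, pi_norm_const, pi_norm_const, pi_norm_const, Fintype.card_fin] at h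
  refine h.trans ?_
  have h2 : max ‖x‖ ‖y‖ ^ (p - 1) ≤ 1 := pow_le_one₀ (le_max_of_le_left (norm_nonneg x))
    (max_le hx hy)
  calc ‖diagForm hp hc‖ * p * max ‖x‖ ‖y‖ ^ (p - 1) * ‖x - y‖ ≤ p * p * 1 * ‖x - y‖ := by gcongr
    _ = (p : ℝ) ^ 2 * ‖x - y‖ := by ring

/-- The diagonal homogeneous polynomial `x ↦ ∑ c_k x_k ^ p` as an element of `H_b`. -/
def diagPoly (hp : 0 < p) {c : ℕ → ℂ} (hc : ∀ k, ‖c k‖ ≤ 1) : Hb (unitBall p) :=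
  ⟨fun x => diagForm hp hc fun _ => (x : Ell p),
    isHolo_of_eq (g := fun x : Ell p => diagForm hp hc fun _ => x) (fun _ => rfl) fun y => by
      have h := (diagForm hp hc).analyticAt (x := fun _ => (y : Ell p))
      exact h.comp (f := fun x : Ell p => fun _ : Fin p => x)
        ((ContinuousLinearMap.pi fun _ : Fin p => ContinuousLinearMap.id ℂ (Ell p)).analyticAt _),
    fun A _ => ⟨1, fun x _ => (norm_diagForm_apply_le hp hc x).trans
      (pow_le_one₀ (norm_nonneg _) (by simpa using (mem_ball.1 x.2).le))⟩⟩

end SequenceSpace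

section Limits

variable {E : Type u} [NormedAddCommGroup E] [NormedSpace ℂ E] {U : Opens E}

/-- `ψ(f) = lim_Γ f(y_n)`, where the `y_n` need to lie in `U` only eventually. -/
def Mb.IsLimit (ψ : Mb U) (y : ℕ → E) (Γ : Ultrafilter ℕ) : Prop :=
  ∀ f : Hb U, Tendsto (fun n => zeroExt U (f : U → ℂ) (y n)) Γ (𝓝 (ψ f))

theorem Mb.IsLimit.unique {ψ ψ' : Mb U} {y : ℕ → E} {Γ : Ultrafilter ℕ} (h : ψ.IsLimit y Γ)
    (h' : ψ'.IsLimit y Γ) : ψ = ψ' :=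
  Mb.ext fun f => tendsto_nhds_unique (h f) (h' f)

theorem Mb.IsLimit.isSupportedBy {ψ : Mb U} {y : ℕ → E} {Γ : Ultrafilter ℕ}
    (h : ψ.IsLimit y Γ) {A : Set U} (hy : ∀ᶠ n in Γ, ∃ a ∈ A, (a : E) = y n) :
    ψ.IsSupportedBy A := by
  intro f M _ hM
  refine le_of_tendsto (h f).norm ?_
  filter_upwards [hy] with n hn
  obtain ⟨a, ha, hay⟩ := hn
  rw [← hay, zeroExt_apply]
  exact hM a ha

theorem exists_isLimit {y : ℕ → E} {Γ : Ultrafilter ℕ} {A : Set U} (hA : IsUBounded U A)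
    (hy : ∀ᶠ n in Γ, ∃ a ∈ A, (a : E) = y n) : ∃ ψ : Mb U, ψ.IsLimit y Γ := by
  have hev : ∀ P : ℂ → ℂ → ℂ → Prop, ∀ f g k : Hb U,
      (∀ a : U, P ((f : U → ℂ) a) ((g : U → ℂ) a) ((k : U → ℂ) a)) →
      ∀ᶠ n in Γ, P (zeroExt U (f : U → ℂ) (y n)) (zeroExt U (g : U → ℂ) (y n))
        (zeroExt U (k : U → ℂ) (y n)) := by
    intro P f g k h
    filter_upwards [hy] with n hn
    obtain ⟨a, -, hay⟩ := hn
    rw [← hay, zeroExt_apply, zeroExt_apply, zeroExt_apply]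
    exact h a
  have hlim : ∀ f : Hb U, ∃ c, Tendsto (fun n => zeroExt U (f : U → ℂ) (y n)) Γ (𝓝 c) := by
    intro f
    obtain ⟨M, hM⟩ := f.2.2 A hA
    have hle : (Γ.map fun n => zeroExt U (f : U → ℂ) (y n) : Filter ℂ) ≤
        𝓟 (closedBall (0 : ℂ) M) := by
      rw [le_principal_iff]
      change ∀ᶠ n in Γ, zeroExt U (f : U → ℂ) (y n) ∈ closedBall (0 : ℂ) M
      filter_upwards [hy] with n hn
      obtain ⟨a, ha, hay⟩ := hn
      rw [← hay, zeroExt_apply, mem_closedBall_zero_iff]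
      exact hM a ha
    obtain ⟨c, -, hc⟩ := (isCompact_closedBall (0 : ℂ) M).ultrafilter_le_nhds _ hle
    exact ⟨c, hc⟩
  choose L hL using hlim
  let φ : Hb U →ₐ[ℂ] ℂ :=
    { toFun := L
      map_one' := tendsto_nhds_unique (hL 1) (tendsto_const_nhds.congr'
        ((hev (fun a _ _ => 1 = a) 1 1 1 fun _ => rfl).mono fun _ h => h))
      map_mul' := fun f g => tendsto_nhds_unique (hL _) (((hL f).mul (hL g)).congr'
        ((hev (fun a b c => a * b = c) f g (f * g) fun _ => rfl).mono fun _ h => h))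
      map_zero' := tendsto_nhds_unique (hL 0) (tendsto_const_nhds.congr'
        ((hev (fun a _ _ => 0 = a) 0 0 0 fun _ => rfl).mono fun _ h => h))
      map_add' := fun f g => tendsto_nhds_unique (hL _) (((hL f).add (hL g)).congr'
        ((hev (fun a b c => a + b = c) f g (f + g) fun _ => rfl).mono fun _ h => h))
      commutes' := fun c => tendsto_nhds_unique (hL _) (tendsto_const_nhds.congr'
        ((hev (fun a _ _ => c = a) (algebraMap ℂ _ c) 0 0 fun _ => rfl).mono fun _ h => h)) }
  refine ⟨⟨φ, continuous_of_norm_le φ hA fun f M _ hM => ?_⟩, hL⟩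
  refine le_of_tendsto (hL f).norm ?_
  filter_upwards [hy] with n hn
  obtain ⟨a, ha, hay⟩ := hn
  rw [← hay, zeroExt_apply]
  exact hM a ha

theorem Mb.IsLimit.isTranslate {ψ ψ' : Mb U} {y : ℕ → E} {Γ : Ultrafilter ℕ} {w : E}
    (h : ψ.IsLimit y Γ) (h' : ψ'.IsLimit (fun n => y n + w) Γ) {A : Set U} {δ : ℝ} (hδ : 0 < δ)
    (hA : ∀ x ∈ A, closedBall (x : E) δ ⊆ (U : Set E))
    (hA' : IsUBounded U {y : U | ∃ x ∈ A, dist (y : E) x ≤ δ})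
    (hy : ∀ᶠ n in Γ, ∃ a ∈ A, (a : E) = y n) (hw : ‖w‖ ≤ δ / 2) : IsTranslate ψ w ψ' := by
  intro f
  obtain ⟨M, hM⟩ := f.2.2 _ hA'
  have hhalf : δ / 2 / δ = 1 / 2 := by field_simp
  have hb : ∀ n, ∀ x ∈ A, ‖(taylorTerm n w f : U → ℂ) x‖ ≤ M * (1 / 2) ^ n := by
    intro n x hx
    have := BoundedType.norm_taylorTerm_le f hδ (half_pos hδ) hw (hA x hx) (fun y hy => hM y ⟨x, hx, hy⟩) n
    rwa [hhalf] at this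
  have hb' : ∀ᶠ m in Γ, ∀ n, ‖zeroExt U (taylorTerm n w f : U → ℂ) (y m)‖ ≤ M * (1 / 2) ^ n := by
    filter_upwards [hy] with m hm n
    obtain ⟨a, ha, hay⟩ := hm
    rw [← hay, zeroExt_apply]
    exact hb n a ha
  have hs : Summable fun n : ℕ => M * (1 / 2 : ℝ) ^ n := summable_geometric_two.mul_left M
  have hlim := tendsto_tsum_of_dominated_convergence hs (fun n => h (taylorTerm n w f)) hb'
  have hlim' : Tendsto (fun m => ∑' n, zeroExt U (taylorTerm n w f : U → ℂ) (y m)) Γ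
      (𝓝 (ψ' f)) := by
    refine (h' f).congr' ?_
    filter_upwards [hy] with m hm
    obtain ⟨a, ha, hay⟩ := hm
    have hmem : (a : E) + w ∈ U := hA a ha (by
      rw [mem_closedBall, dist_eq_norm, add_sub_cancel_left]
      linarith)
    simp only [← hay, zeroExt_apply]
    rw [(hasSum_taylorTerm f (by linarith) (hA a ha) hmem).tsum_eq]
    exact zeroExt_apply U (f : U → ℂ) ⟨_, hmem⟩
  rw [tendsto_nhds_unique hlim' hlim]
  refine (Summable.of_norm_bounded hs fun n => ?_).hasSum
  exact le_of_tendsto (h (taylorTerm n w f)).norm (hb'.mono fun m hm => hm n)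

end Limits

/-! ### Sheets -/

section Sheets

variable {E : Type u} [NormedAddCommGroup E] [NormedSpace ℂ E] {U : Opens E}

theorem inclusionInDoubleDual_injective :
    Function.Injective (NormedSpace.inclusionInDoubleDual ℂ E) :=
  (NormedSpace.inclusionInDoubleDualLi ℂ (E := E)).injective

theorem proj_eq {φ : Mb U} {z : E} (h : bidualProj φ = NormedSpace.inclusionInDoubleDual ℂ E z) :
    proj φ = z := by
  rw [proj, h]
  exact Function.leftInverse_invFun inclusionInDoubleDual_injective z

/-- `σ` is a section of `π` over the ball of radius `ρ`, compatible with small translations. -/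
structure IsSheetSection (ρ : ℝ) (σ : E → Mb U) : Prop where
  bidualProj_eq : ∀ z, ‖z‖ < ρ → bidualProj (σ z) = NormedSpace.inclusionInDoubleDual ℂ E z
  exists_isTranslate : ∀ z, ‖z‖ < ρ → ∃ δ : ℝ, 0 < δ ∧
    ∀ w, ‖w‖ < δ → ‖z + w‖ < ρ ∧ IsTranslate (σ z) w (σ (z + w))

variable {ρ : ℝ} {σ : E → Mb U}

theorem IsSheetSection.proj_apply (h : IsSheetSection ρ σ) {z : E} (hz : ‖z‖ < ρ) :
    proj (σ z) = z :=
  proj_eq (h.bidualProj_eq z hz)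

theorem IsSheetSection.isOpen_image (h : IsSheetSection ρ σ) {V : Set E} (hV : IsOpen V) :
    IsOpen (σ '' (V ∩ ball 0 ρ)) := by
  rintro _ ⟨z, ⟨hzV, hz⟩, rfl⟩
  obtain ⟨δ, hδ, hT⟩ := h.exists_isTranslate z (by simpa using hz)
  obtain ⟨ε, hε, hball⟩ := Metric.isOpen_iff.1 hV z hzV
  refine ⟨min δ ε, lt_min hδ hε, fun w ψ hw hψ => ?_⟩
  obtain ⟨h1, h2⟩ := hT w (hw.trans_le (min_le_left _ _))
  refine ⟨z + w, ⟨hball ?_, by simpa using h1⟩, h2.unique hψ⟩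
  simpa using hw.trans_le (min_le_right _ _)

theorem IsSheetSection.isOpen_range (h : IsSheetSection ρ σ) : IsOpen (σ '' ball 0 ρ) := by
  simpa using h.isOpen_image isOpen_univ

theorem IsSheetSection.continuousOn (h : IsSheetSection ρ σ) : ContinuousOn σ (ball 0 ρ) := by
  refine (continuousOn_open_iff isOpen_ball).2 fun O hO => Metric.isOpen_iff.2 ?_
  rintro z ⟨hz, hzO⟩
  obtain ⟨δ, hδ, hT⟩ := h.exists_isTranslate z (by simpa using hz)
  obtain ⟨ε, hε, hO'⟩ := hO (σ z) hzO
  refine ⟨min δ ε, lt_min hδ hε, fun y hy => ?_⟩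
  rw [mem_ball, dist_eq_norm] at hy
  obtain ⟨h1, h2⟩ := hT (y - z) (hy.trans_le (min_le_left _ _))
  rw [add_sub_cancel] at h1 h2
  exact ⟨by simpa using h1, hO' _ _ (hy.trans_le (min_le_right _ _)) h2⟩

theorem IsSheetSection.connectedComponent_eq (h : IsSheetSection ρ σ)
    (hc : IsClosed (σ '' ball 0 ρ)) {z : E} (hz : ‖z‖ < ρ) :
    connectedComponent (σ z) = σ '' ball 0 ρ := by
  have hmem : σ z ∈ σ '' ball 0 ρ := ⟨z, by simpa using hz, rfl⟩
  exact (IsClopen.connectedComponent_subset ⟨hc, h.isOpen_range⟩ hmem).antisymm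
    (((convex_ball (0 : E) ρ).isPreconnected.image σ h.continuousOn).subset_connectedComponent
      hmem)

/-- A sheet is closed as soon as it does not accumulate at points over the complement of the
ball. -/
theorem IsSheetSection.isClosed_range (h : IsSheetSection ρ σ)
    (hbdry : ∀ (ψ : Mb U) (a : E), ρ ≤ ‖a‖ → ∃ ε : ℝ, 0 < ε ∧
      ∀ w, ‖w‖ < ε → ‖a + w‖ < ρ → ¬ IsTranslate ψ w (σ (a + w))) :
    IsClosed (σ '' ball 0 ρ) := by
  refine ⟨fun ψ hψ => ?_⟩
  by_cases hrange : ∃ a, bidualProj ψ = NormedSpace.inclusionInDoubleDual ℂ E a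
  · obtain ⟨a, ha⟩ := hrange
    have hz_eq : ∀ {w z : E}, ‖z‖ < ρ → IsTranslate ψ w (σ z) → z = a + w := fun hz hT => by
      refine inclusionInDoubleDual_injective ?_
      rw [map_add, ← ha, ← h.bidualProj_eq _ hz, hT.bidualProj_eq]
    rcases lt_or_ge ‖a‖ ρ with hlt | hge
    · obtain ⟨δ, hδ, hT⟩ := h.exists_isTranslate a hlt
      obtain ⟨ε, hε, hinj⟩ := Mb.exists_eq_of_isTranslate ψ (σ a)
      refine ⟨min δ ε, lt_min hδ hε, ?_⟩
      rintro w _ hw hψ' ⟨z, hz, rfl⟩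
      rw [mem_ball_zero_iff] at hz
      obtain rfl := hz_eq hz hψ'
      refine hψ ⟨a, by simpa using hlt, ?_⟩
      exact (hinj w _ (hw.trans_le (min_le_right _ _)) hψ'
        (hT w (hw.trans_le (min_le_left _ _))).2).symm
    · obtain ⟨ε, hε, hε'⟩ := hbdry ψ a hge
      refine ⟨ε, hε, ?_⟩
      rintro w _ hw hψ' ⟨z, hz, rfl⟩
      rw [mem_ball_zero_iff] at hz
      obtain rfl := hz_eq hz hψ'
      exact hε' w hw hz hψ'
  · refine ⟨1, one_pos, ?_⟩
    rintro w _ hw hψ' ⟨z, hz, rfl⟩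
    rw [mem_ball_zero_iff] at hz
    refine hrange ⟨z - w, ?_⟩
    rw [map_sub, ← h.bidualProj_eq _ hz, hψ'.bidualProj_eq]
    ext γ
    simp

end Sheets

/-! ### Sheets of block limits -/

section BlockLimits

variable {p : ℕ} [Fact (1 ≤ (p : ℝ≥0∞))]

/-- The points of the unit ball of norm at most `s`. -/
def subBall (p : ℕ) [Fact (1 ≤ (p : ℝ≥0∞))] (s : ℝ) : Set (unitBall p) :=
  {x | ‖(x : Ell p)‖ ≤ s}

theorem closedBall_subset_unitBall {s δ : ℝ} (h : s + δ < 1) :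
    ∀ x ∈ subBall p s, closedBall (x : Ell p) δ ⊆ (unitBall p : Set (Ell p)) := by
  intro x hx y hy
  have hx' : ‖(x : Ell p)‖ ≤ s := hx
  have h1 := norm_le_norm_add_norm_sub' y (x : Ell p)
  rw [mem_closedBall, dist_eq_norm] at hy
  change y ∈ ball 0 1
  rw [mem_ball_zero_iff]
  linarith

theorem isUBounded_subBall {s : ℝ} (hs : s < 1) : IsUBounded (unitBall p) (subBall p s) := by
  refine ⟨(isBounded_closedBall (x := (0 : Ell p)) (r := s)).subset ?_, (1 - s) / 2, by linarith,
    fun x hx => ball_subset_closedBall.trans (closedBall_subset_unitBall (by linarith) x hx)⟩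
  rintro _ ⟨x, hx, rfl⟩
  exact mem_closedBall_zero_iff.2 hx

theorem IsUBounded.subset_subBall {A : Set (unitBall p)} (hA : IsUBounded (unitBall p) A) :
    ∃ s : ℝ, 0 ≤ s ∧ s < 1 ∧ A ⊆ subBall p s := by
  obtain ⟨-, δ, hδ, h⟩ := hA
  refine ⟨max (1 - δ) 0, le_max_right _ _, max_lt (by linarith) one_pos, fun x hx => ?_⟩
  have := norm_add_le_of_ball_subset_ball hδ (h x hx)
  have hle : ‖(x : Ell p)‖ ≤ 1 - δ := by linarith
  exact hle.trans (le_max_left _ _)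

theorem IsUBounded.of_subset_subBall {A : Set (unitBall p)} {s : ℝ} (hs : s < 1)
    (h : A ⊆ subBall p s) : IsUBounded (unitBall p) A := by
  obtain ⟨h1, δ, hδ, h2⟩ := isUBounded_subBall (p := p) hs
  exact ⟨h1.subset (Set.image_mono h), δ, hδ, fun x hx => h2 x (h hx)⟩

theorem exists_mem_subBall {s : ℝ} (hs : s < 1) {y : Ell p} (hy : ‖y‖ ≤ s) :
    ∃ a ∈ subBall p s, (a : Ell p) = y :=
  ⟨⟨y, mem_ball_zero_iff.2 (hy.trans_lt hs)⟩, hy, rfl⟩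

variable {x : ℕ → unitBall p} {Γ : Ultrafilter ℕ} {r : ℝ}

omit [Fact (1 ≤ (p : ℝ≥0∞))] in
theorem exists_lt_one_pow_lt {t : ℝ} (ht : t < 1) :
    ∃ s : ℝ, 0 ≤ s ∧ s < 1 ∧ t < s ^ p := by
  have hc : ContinuousAt (fun s : ℝ => s ^ p) 1 := by fun_prop
  have h := hc.tendsto.mono_left (nhdsWithin_le_nhds (s := Set.Iio (1 : ℝ)))
  simp only [one_pow] at h
  obtain ⟨s, h1, h2⟩ := ((h.eventually_const_lt ht).and
    (Ioo_mem_nhdsLT (one_pos (α := ℝ)))).exists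
  exact ⟨s, h2.1.le, h2.2, h1⟩

theorem IsBlockData.eventually_mem_subBall (hx : IsBlockData x r) (hp : 0 < p)
    (hΓ : (Γ : Filter ℕ) ≤ atTop) {s : ℝ} (hs0 : 0 ≤ s) (hs : s < 1) {z : Ell p}
    (hz : r ^ p + ‖z‖ ^ p < s ^ p) :
    ∀ᶠ n in Γ, ∃ a ∈ subBall p s, (a : Ell p) = x n + z :=
  hΓ ((hx.eventually_norm_add_lt hp hs0 hz).mono fun _ hn => exists_mem_subBall hs hn.le)

theorem IsBlockData.exists_isLimit (hx : IsBlockData x r) (hp : 0 < p)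
    (hΓ : (Γ : Filter ℕ) ≤ atTop) {z : Ell p} (hz : r ^ p + ‖z‖ ^ p < 1) :
    ∃ ψ : Mb (unitBall p), ψ.IsLimit (fun n => (x n : Ell p) + z) Γ := by
  obtain ⟨s, hs0, hs, hzs⟩ := exists_lt_one_pow_lt (p := p) hz
  exact BoundedType.exists_isLimit (isUBounded_subBall hs)
    (hx.eventually_mem_subBall hp hΓ hs0 hs hzs)

theorem IsBlockData.exists_isTranslate (hx : IsBlockData x r) (hp : 0 < p)
    (hΓ : (Γ : Filter ℕ) ≤ atTop) {z : Ell p} (hz : r ^ p + ‖z‖ ^ p < 1) {ψ : Mb (unitBall p)}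
    (hψ : ψ.IsLimit (fun n => (x n : Ell p) + z) Γ) : ∃ δ : ℝ, 0 < δ ∧
      ∀ (w : Ell p) (ψ' : Mb (unitBall p)), ‖w‖ < δ →
        ψ'.IsLimit (fun n => (x n : Ell p) + (z + w)) Γ → IsTranslate ψ w ψ' := by
  obtain ⟨s, hs0, hs, hzs⟩ := exists_lt_one_pow_lt (p := p) hz
  refine ⟨(1 - s) / 2 / 2, by linarith, fun w ψ' hw hψ' => ?_⟩
  refine hψ.isTranslate (A := subBall p s) (δ := (1 - s) / 2) ?_ (by linarith)
    (closedBall_subset_unitBall (by linarith)) ?_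
    (hx.eventually_mem_subBall hp hΓ hs0 hs hzs) hw.le
  · simpa only [add_assoc] using hψ'
  · refine IsUBounded.of_subset_subBall (s := (1 + s) / 2) (by linarith) ?_
    rintro y ⟨a, ha, hya⟩
    have ha' : ‖(a : Ell p)‖ ≤ s := ha
    have := norm_le_norm_add_norm_sub' (y : Ell p) (a : Ell p)
    rw [dist_eq_norm] at hya
    change ‖(y : Ell p)‖ ≤ _
    linarith

theorem IsBlockData.bidualProj_eq (hx : IsBlockData x r) (hp : 1 < p)
    (hΓ : (Γ : Filter ℕ) ≤ atTop) {z : Ell p} (hz : r ^ p + ‖z‖ ^ p < 1) {ψ : Mb (unitBall p)}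
    (hψ : ψ.IsLimit (fun n => (x n : Ell p) + z) Γ) :
    bidualProj ψ = NormedSpace.inclusionInDoubleDual ℂ (Ell p) z := by
  ext γ
  rw [NormedSpace.dual_def, bidualProj_apply]
  refine tendsto_nhds_unique (hψ (dualRestrict _ γ)) ?_
  have h0 := (hx.1.tendsto_dual hp (fun n => (mem_ball_zero_iff.1 (x n).2).le) γ).mono_left hΓ
  have h1 := h0.add_const (γ z)
  rw [zero_add] at h1
  refine h1.congr' ?_
  obtain ⟨s, hs0, hs, hzs⟩ := exists_lt_one_pow_lt (p := p) hz
  filter_upwards [hx.eventually_mem_subBall (by omega) hΓ hs0 hs hzs] with n hn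
  obtain ⟨a, -, ha⟩ := hn
  rw [← ha, zeroExt_apply]
  change _ = γ a
  rw [ha, map_add]

omit [Fact (1 ≤ (p : ℝ≥0∞))] in
/-- A coefficient aligning the phase of a `p`-th power. -/
theorem exists_phase (hp : 0 < p) (w : ℂ) : ∃ c : ℂ, ‖c‖ ≤ 1 ∧ c * w ^ p = ((‖w‖ ^ p : ℝ) : ℂ) := by
  rcases eq_or_ne w 0 with rfl | hw
  · exact ⟨0, by simp, by simp [hp.ne']⟩
  · have hw' : (‖w‖ : ℂ) ≠ 0 := by simpa using hw
    refine ⟨((‖w‖ : ℂ) / w) ^ p, ?_, ?_⟩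
    · rw [norm_pow, norm_div, Complex.norm_real, norm_norm, div_self (norm_ne_zero_iff.2 hw),
        one_pow]
    · rw [← mul_pow, div_mul_cancel₀ _ hw, Complex.ofReal_pow]

theorem IsBlockData.exists_diagPoly (hx : IsBlockData x r) (hp : 0 < p) (z : Ell p) (K : ℕ) :
    ∃ (c : ℕ → ℂ) (hc : ∀ k, ‖c k‖ ≤ 1), ∀ᶠ n in atTop,
      (diagForm hp hc fun _ => (x n : Ell p) + Ell.trunc z K) =
        ((‖(x n : Ell p)‖ ^ p + ‖Ell.trunc z K‖ ^ p : ℝ) : ℂ) := by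
  classical
  choose phase hphase1 hphase2 using fun w : ℂ => exists_phase hp w
  set a : ℕ → ℂ := fun k => if k < K then z k else
    if h : ∃ n, (x n : Ell p) k ≠ 0 then (x h.choose : Ell p) k else 0 with ha
  have hxa : ∀ n k, ¬ k < K → (x n : Ell p) k ≠ 0 → a k = (x n : Ell p) k := by
    intro n k hk hn
    have h : ∃ n, (x n : Ell p) k ≠ 0 := ⟨n, hn⟩
    simp only [ha, if_neg hk, dif_pos h]
    by_cases hm : h.choose = n
    · rw [hm]
    · exact absurd ((hx.1.disjoint hm k).resolve_left h.choose_spec) hn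
  refine ⟨fun k => phase (a k), fun k => hphase1 _, ?_⟩
  filter_upwards [hx.1.eventually_eq_zero K, hx.eventually_norm_add_trunc hp z K] with n hn hnorm
  rw [← hnorm]
  refine (hasSum_diagForm hp _ _).unique ?_
  refine (Complex.hasSum_ofReal.2 (Ell.hasSum_norm_pow hp
    ((x n : Ell p) + Ell.trunc z K))).congr_fun fun k => ?_
  rw [lp.coeFn_add, Pi.add_apply, Ell.trunc_apply]
  split_ifs with hk
  · rw [hn k hk, zero_add, ← hphase2, show a k = z k from if_pos hk]
  · rw [add_zero]
    by_cases hk0 : (x n : Ell p) k = 0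
    · simp [hk0, hp.ne']
    · rw [← hphase2, hxa n k hk hk0]

/-- A lower bound for the support of the limit along a translated block basis. -/
theorem IsBlockData.pow_add_norm_pow_le (hx : IsBlockData x r) (hp : 0 < p)
    (hΓ : (Γ : Filter ℕ) ≤ atTop) {z : Ell p} (hz : r ^ p + ‖z‖ ^ p < 1) {ψ : Mb (unitBall p)}
    (hψ : ψ.IsLimit (fun n => (x n : Ell p) + z) Γ) {s : ℝ} (hs : 0 ≤ s)
    (hsupp : ψ.IsSupportedBy (subBall p s)) : r ^ p + ‖z‖ ^ p ≤ s ^ p := by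
  have key : ∀ K, r ^ p + ‖Ell.trunc z K‖ ^ p ≤ s ^ p + (p : ℝ) ^ 2 * ‖z - Ell.trunc z K‖ := by
    intro K
    obtain ⟨c, hc, hcn⟩ := hx.exists_diagPoly hp z K
    have hle : ‖ψ (diagPoly hp hc)‖ ≤ s ^ p := hsupp _ _ (by positivity) fun y hy =>
      (norm_diagForm_apply_le hp hc y).trans (pow_le_pow_left₀ (norm_nonneg _) hy p)
    have hlim1 : Tendsto (fun n => ‖(x n : Ell p)‖ ^ p + ‖Ell.trunc z K‖ ^ p) Γ
        (𝓝 (r ^ p + ‖Ell.trunc z K‖ ^ p)) :=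
      ((hx.2.2.2.mono_left hΓ).pow p).add_const _
    have hlim2 := ((hψ (diagPoly hp hc)).norm.add_const ((p : ℝ) ^ 2 * ‖z - Ell.trunc z K‖))
    refine (le_of_tendsto_of_tendsto hlim1 hlim2 ?_).trans (by linarith)
    have hz' : r ^ p + ‖z‖ ^ p < 1 ^ p := by simpa using hz
    filter_upwards [hΓ hcn, hΓ (hx.eventually_norm_add_lt hp zero_le_one hz'),
      hΓ (hx.eventually_norm_add_trunc_lt hp zero_le_one hz' K)] with n h1 h2 h3
    have h4 := norm_diagForm_sub_le hp hc h3.le h2.le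
    have e : zeroExt (unitBall p) (diagPoly hp hc : unitBall p → ℂ) ((x n : Ell p) + z) =
        diagForm hp hc fun _ => (x n : Ell p) + z :=
      zeroExt_apply (unitBall p) _ ⟨_, mem_ball_zero_iff.2 h2⟩
    rw [e]
    rw [h1, add_sub_add_left_eq_sub, norm_sub_rev (Ell.trunc z K)] at h4
    have h5 := (norm_sub_norm_le _ _).trans h4
    rw [Complex.norm_real, Real.norm_of_nonneg (by positivity)] at h5
    linarith
  have hT := Ell.tendsto_trunc z
  have h1 : Tendsto (fun K => r ^ p + ‖Ell.trunc z K‖ ^ p) atTop (𝓝 (r ^ p + ‖z‖ ^ p)) :=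
    (hT.norm.pow p).const_add _
  have h2 : Tendsto (fun K => s ^ p + (p : ℝ) ^ 2 * ‖z - Ell.trunc z K‖) atTop (𝓝 (s ^ p)) := by
    simpa using ((hT.const_sub z).norm.const_mul ((p : ℝ) ^ 2)).const_add (s ^ p)
  exact le_of_tendsto_of_tendsto' h1 h2 key

/-- The radius of the sheet of a block limit with parameter `r`. -/
def sheetRadius (p : ℕ) (r : ℝ) : ℝ := (1 - r ^ p) ^ (1 / (p : ℝ))

omit [Fact (1 ≤ (p : ℝ≥0∞))] in
theorem sheetRadius_pow (hp : 0 < p) (hr0 : 0 ≤ r) (hr : r ≤ 1) :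
    sheetRadius p r ^ p = 1 - r ^ p := by
  rw [sheetRadius, one_div]
  exact Real.rpow_inv_natCast_pow (sub_nonneg.2 (pow_le_one₀ hr0 hr)) hp.ne'

omit [Fact (1 ≤ (p : ℝ≥0∞))] in
theorem sheetRadius_pos (hr0 : 0 ≤ r) (hr : r < 1) (hp : 0 < p) : 0 < sheetRadius p r :=
  Real.rpow_pos_of_pos (sub_pos.2 (pow_lt_one₀ hr0 hr hp.ne')) _

/-- The sheet of a block limit with parameter `r` is a copy of the ball of radius
`(1 - r ^ p) ^ (1 / p)`. -/
theorem IsBlockLimit.exists_section (hp : 1 < p) {φ : Mb (unitBall p)} (hφ : IsBlockLimit r φ) :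
    ∃ σ : Ell p → Mb (unitBall p), σ 0 = φ ∧ IsSheetSection (sheetRadius p r) σ ∧
      IsClosed (σ '' ball 0 (sheetRadius p r)) ∧ 0 < sheetRadius p r ∧
      sheetRadius p r ^ p = 1 - r ^ p ∧
      ∀ z, ∀ s : ℝ, 0 ≤ s → s < 1 → r ^ p + ‖z‖ ^ p < s ^ p →
        (σ z).IsSupportedBy (subBall p s) := by
  have hp0 : 0 < p := by omega
  obtain ⟨x, Γ, hx, hΓ', hlim⟩ := hφ
  obtain ⟨-, hr0, hr1, -⟩ := id hx
  have hΓ : (Γ : Filter ℕ) ≤ atTop := by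
    rw [atTop_basis.ge_iff]
    exact fun n _ => hΓ' n
  have hφ0 : φ.IsLimit (fun n => (x n : Ell p) + 0) Γ := fun f => by
    simpa only [add_zero, zeroExt_apply] using hlim f
  have hρ := sheetRadius_pow hp0 hr0.le hr1.le
  have hρ0 := sheetRadius_pos hr0.le hr1 hp0
  set ρ := sheetRadius p r
  have hball : ∀ {z : Ell p}, ‖z‖ < ρ → r ^ p + ‖z‖ ^ p < 1 := fun hz => by
    have := pow_lt_pow_left₀ hz (norm_nonneg _) hp0.ne'
    linarith
  have hex : ∀ z : Ell p, ∃ ψ : Mb (unitBall p),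
      r ^ p + ‖z‖ ^ p < 1 → ψ.IsLimit (fun n => (x n : Ell p) + z) Γ := fun z => by
    by_cases hz : r ^ p + ‖z‖ ^ p < 1
    · obtain ⟨ψ, hψ⟩ := hx.exists_isLimit hp0 hΓ hz
      exact ⟨ψ, fun _ => hψ⟩
    · exact ⟨φ, fun h => absurd h hz⟩
  choose σ hσ using hex
  have hsheet : IsSheetSection ρ σ := by
    refine ⟨fun z hz => hx.bidualProj_eq hp hΓ (hball hz) (hσ z (hball hz)), fun z hz => ?_⟩
    obtain ⟨δ, hδ, hT⟩ := hx.exists_isTranslate hp0 hΓ (hball hz) (hσ z (hball hz))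
    refine ⟨min δ (ρ - ‖z‖), lt_min hδ (sub_pos.2 hz), fun w hw => ?_⟩
    have hzw : ‖z + w‖ < ρ := by
      have := norm_add_le z w
      have := hw.trans_le (min_le_right _ _)
      linarith
    exact ⟨hzw, hT w _ (hw.trans_le (min_le_left _ _)) (hσ _ (hball hzw))⟩
  refine ⟨σ, (hσ 0 (hball (by simpa using hρ0))).unique hφ0, hsheet, hsheet.isClosed_range ?_, hρ0,
    hρ, fun z s hs0 hs hzs => (hσ z (hzs.trans_le (pow_le_one₀ hs0 hs.le))).isSupportedBy
      (hx.eventually_mem_subBall hp0 hΓ hs0 hs hzs)⟩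
  intro ψ a ha
  obtain ⟨A, hA, hψ⟩ := ψ.exists_isSupportedBy
  obtain ⟨δ, hδ, hA1, hA2⟩ := hA.exists_closedBall
  obtain ⟨s, hs0, hs1, hAs⟩ := hA2.subset_subBall
  obtain ⟨t, ht, htρ, ht0⟩ : ∃ t : ℝ, s ^ p < r ^ p + t ^ p ∧ t < ρ ∧ 0 < t := by
    have hc : ContinuousAt (fun t : ℝ => r ^ p + t ^ p) ρ := by fun_prop
    have h := hc.tendsto.mono_left (nhdsWithin_le_nhds (s := Set.Iio ρ))
    have hlt : s ^ p < r ^ p + ρ ^ p := by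
      rw [hρ]
      have := pow_lt_one₀ hs0 hs1 hp0.ne'
      linarith
    obtain ⟨t, h1, h2⟩ := ((h.eventually_const_lt hlt).and (Ioo_mem_nhdsLT hρ0)).exists
    exact ⟨t, h1, h2.2, h2.1⟩
  refine ⟨min (δ / 2) (ρ - t), lt_min (half_pos hδ) (sub_pos.2 htρ), fun w hw haw hT => ?_⟩
  have hsupp := hT.isSupportedBy hψ hδ hA1 (hw.trans_le (min_le_left _ _)).le
  have h1 := hx.pow_add_norm_pow_le hp0 hΓ (hball haw) (hσ _ (hball haw)) hs0
    fun f M hM hf => hsupp f M hM fun y hy => hf y (hAs hy)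
  have h2 : t ≤ ‖a + w‖ := by
    have h3 := norm_sub_norm_le a (-w)
    rw [norm_neg, sub_neg_eq_add] at h3
    have := hw.trans_le (min_le_right _ _)
    linarith
  have := pow_le_pow_left₀ ht0.le h2 p
  linarith

end BlockLimits

section Distinguished

variable {p : ℕ} [Fact (1 ≤ (p : ℝ≥0∞))]

theorem IsBlockLimit.proj_image_connectedComponent (hp : 1 < p) {r : ℝ} {φ : Mb (unitBall p)}
    (hφ : IsBlockLimit r φ) : proj '' connectedComponent φ = ball 0 (sheetRadius p r) := by
  obtain ⟨σ, rfl, hσ, hc, hρ, -, -⟩ := hφ.exists_section hp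
  rw [hσ.connectedComponent_eq hc (by simpa using hρ), Set.image_image]
  exact (Set.image_congr fun z hz => hσ.proj_apply (mem_ball_zero_iff.1 hz)).trans
    (Set.image_id' _)

/-- The block limits, which index the sheets of the distinguished spectrum. -/
abbrev BlockLimit (p : ℕ) [Fact (1 ≤ (p : ℝ≥0∞))] : Type :=
  {φ : Mb (unitBall p) // ∃ r : ℝ, IsBlockLimit r φ}

theorem mem_mb0_iff {ψ : Mb (unitBall p)} :
    ψ ∈ Mb0 p ↔ ∃ φ : BlockLimit p, ψ ∈ connectedComponent φ.1 := by
  simp [Mb0]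

/-- The distinguished spectrum is a disjoint union of balls, indexed by the block limits. -/
theorem exists_isBallUnion_mb0 (hp : 1 < p) :
    ∃ (r : BlockLimit p → ℝ) (ι : Mb0 p → BlockLimit p) (σ : BlockLimit p → Ell p → Mb0 p),
      IsBallUnion (proj0 p) ι (fun φ => sheetRadius p (r φ)) σ ∧
      (∀ φ, sheetRadius p (r φ) ^ p = 1 - r φ ^ p) ∧
      (∀ φ, IsSheetSection (sheetRadius p (r φ)) fun z => (σ φ z).1) ∧
      (∀ φ z, ‖z‖ < sheetRadius p (r φ) → ∀ s : ℝ, 0 ≤ s → s < 1 → r φ ^ p + ‖z‖ ^ p < s ^ p →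
        (σ φ z).1.IsSupportedBy (subBall p s)) ∧ IsOpen (Mb0 p) := by
  classical
  choose r hr using fun φ : BlockLimit p => φ.2
  choose τ hτ0 hτ hτc hρ hρp hτs using fun φ : BlockLimit p => (hr φ).exists_section hp
  have hcomp : ∀ φ : BlockLimit p,
      connectedComponent φ.1 = τ φ '' ball 0 (sheetRadius p (r φ)) := fun φ => by
    rw [← (hτ φ).connectedComponent_eq (hτc φ) (z := 0) (by simpa using hρ φ), hτ0]
  have hmem : ∀ (φ : BlockLimit p) {z}, ‖z‖ < sheetRadius p (r φ) → τ φ z ∈ Mb0 p :=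
    fun φ z hz => mem_mb0_iff.2 ⟨φ, hcomp φ ▸ ⟨z, by simpa using hz, rfl⟩⟩
  have hdisj : ∀ {φ φ' : BlockLimit p} {z}, ‖z‖ < sheetRadius p (r φ) →
      τ φ z ∈ connectedComponent φ'.1 → φ = φ' := by
    intro φ φ' z hz hmem'
    have h1 : τ φ z ∈ connectedComponent φ.1 := by
      rw [hcomp]
      exact ⟨z, by simpa using hz, rfl⟩
    have h2 : φ.1 ∈ connectedComponent φ'.1 := by
      rw [connectedComponent_eq hmem', ← connectedComponent_eq h1]
      exact mem_connectedComponent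
    rw [hcomp] at h2
    obtain ⟨w, hw, hwφ⟩ := h2
    rw [mem_ball_zero_iff] at hw
    have h3 := (hτ φ').proj_apply hw
    rw [hwφ, ← hτ0 φ, (hτ φ).proj_apply (by simpa using hρ φ)] at h3
    rw [← h3, hτ0] at hwφ
    exact Subtype.ext hwφ.symm
  choose ι hι using fun ψ : Mb0 p => mem_mb0_iff.1 ψ.2
  have hι' : ∀ ψ : Mb0 p, ∃ z, ‖z‖ < sheetRadius p (r (ι ψ)) ∧ τ (ι ψ) z = ψ.1 := fun ψ => by
    have := hι ψ
    rw [hcomp] at this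
    obtain ⟨z, hz, h⟩ := this
    exact ⟨z, by simpa using hz, h⟩
  have hself : ∀ φ : BlockLimit p, φ.1 ∈ Mb0 p := fun φ => mem_mb0_iff.2 ⟨φ, mem_connectedComponent⟩
  set σ : BlockLimit p → Ell p → Mb0 p := fun φ z =>
    if hz : ‖z‖ < sheetRadius p (r φ) then ⟨τ φ z, hmem φ hz⟩ else ⟨φ.1, hself φ⟩ with hσ
  have hστ : ∀ φ z, ‖z‖ < sheetRadius p (r φ) → (σ φ z).1 = τ φ z := fun φ z hz => by
    simp only [hσ, dif_pos hz]
  have hopen : IsOpen (Mb0 p) := by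
    have e : Mb0 p = ⋃ φ : BlockLimit p, connectedComponent φ.1 := by
      ext ψ
      simp [mem_mb0_iff]
    rw [e]
    exact isOpen_iUnion fun φ => hcomp φ ▸ (hτ φ).isOpen_range
  refine ⟨r, ι, σ, ?_, hρp, fun φ => ⟨fun z hz => ?_, fun z hz => ?_⟩,
    fun φ z hz => ?_, hopen⟩
  · have hsp : ∀ φ z, ‖z‖ < sheetRadius p (r φ) → proj0 p (σ φ z) = z := fun φ z hz => by
      rw [proj0, hστ φ z hz, (hτ φ).proj_apply hz]
    have his : ∀ φ z, ‖z‖ < sheetRadius p (r φ) → ι (σ φ z) = φ := fun φ z hz => by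
      refine (hdisj hz ?_).symm
      rw [← hστ φ z hz]
      exact hι _
    have hnorm : ∀ ψ, ‖proj0 p ψ‖ < sheetRadius p (r (ι ψ)) := fun ψ => by
      obtain ⟨z, hz, h⟩ := hι' ψ
      rwa [proj0, ← h, (hτ _).proj_apply hz]
    have hsec : ∀ ψ, σ (ι ψ) (proj0 p ψ) = ψ := fun ψ => by
      refine Subtype.ext ?_
      rw [hστ _ _ (hnorm ψ)]
      obtain ⟨z, hz, h⟩ := hι' ψ
      rw [proj0, ← h, (hτ _).proj_apply hz]
    refine ⟨⟨fun V hV => ?_⟩, fun S => ?_, hnorm, hsec, hsp, his, fun φ => ?_⟩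
    · refine isOpen_induced_iff.2 ⟨⋃ φ : BlockLimit p, τ φ '' (V ∩ ball 0 (sheetRadius p (r φ))),
        isOpen_iUnion fun φ => (hτ φ).isOpen_image hV, Set.ext fun ψ => ?_⟩
      simp only [Set.mem_preimage, Set.mem_iUnion]
      constructor
      · rintro ⟨φ, z, ⟨hzV, hz⟩, h⟩
        rw [mem_ball_zero_iff] at hz
        rwa [proj0, ← h, (hτ φ).proj_apply hz]
      · intro hψ
        obtain ⟨z, hz, h⟩ := hι' ψ
        rw [proj0, ← h, (hτ _).proj_apply hz] at hψ
        exact ⟨ι ψ, z, ⟨hψ, by simpa using hz⟩, h⟩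
    · refine isOpen_induced_iff.2 ⟨⋃ φ ∈ S, connectedComponent φ.1,
        isOpen_biUnion fun φ _ => hcomp φ ▸ (hτ φ).isOpen_range, Set.ext fun ψ => ?_⟩
      simp only [Set.mem_preimage, Set.mem_iUnion]
      constructor
      · rintro ⟨φ, hφ, hψ⟩
        obtain ⟨z, hz, h⟩ := hι' ψ
        rw [← h] at hψ
        rwa [hdisj hz hψ]
      · exact fun hψ => ⟨ι ψ, hψ, hι ψ⟩
    · rw [Topology.IsInducing.subtypeVal.continuousOn_iff]
      exact (hτ φ).continuousOn.congr fun z hz => hστ φ z (by simpa using hz)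
  · simp only [hστ φ z hz]
    exact (hτ φ).bidualProj_eq z hz
  · obtain ⟨δ, hδ, h⟩ := (hτ φ).exists_isTranslate z hz
    refine ⟨δ, hδ, fun w hw => ⟨(h w hw).1, ?_⟩⟩
    rw [hστ φ z hz, hστ φ _ (h w hw).1]
    exact (h w hw).2
  · rw [hστ φ z hz]
    exact hτs φ z

/-- Gelfand transforms are holomorphic of bounded type on the distinguished spectrum. -/
theorem isHbOn_gelfand (hp : 1 < p) (f : Hb (unitBall p)) :
    IsHbOn (proj0 p) fun φ => gelfand f φ.1 := by
  have hp0 : 0 < p := by omega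
  obtain ⟨r, ι, σ, h, hρ, hσ, hsupp, -⟩ := exists_isBallUnion_mb0 (p := p) hp
  refine ⟨fun ψ => ?_, fun A hA => ?_⟩
  · obtain ⟨δ, hδ, hT⟩ := (hσ (ι ψ)).exists_isTranslate (proj0 p ψ) (h.norm_lt ψ)
    obtain ⟨g, hg, hg'⟩ := ψ.1.exists_analyticAt_translate f (proj0 p ψ)
    refine ⟨g, hg, ?_⟩
    filter_upwards [(IsLocallyConstant.iff_eventually_eq ι).1 h.isLocallyConstant ψ,
      h.continuous_proj.continuousAt.preimage_mem_nhds (ball_mem_nhds (proj0 p ψ) hδ)] with ψ' h1 h2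
    rw [Set.mem_preimage, mem_ball, dist_eq_norm] at h2
    have h3 := (hT _ h2).2
    rw [add_sub_cancel, h.section_proj, ← h1, h.section_proj] at h3
    have h4 := hg' _ _ h3
    rw [add_sub_cancel] at h4
    exact h4.symm
  · rcases A.eq_empty_or_nonempty with rfl | hne
    · exact ⟨0, by simp⟩
    obtain ⟨δ, hδ, hle⟩ := h.exists_norm_add_le hA
    obtain ⟨s, hs0, hs1, hs⟩ := exists_lt_one_pow_lt (p := p) (t := 1 - δ ^ p)
      (by have := pow_pos hδ p; linarith)
    obtain ⟨M, hM⟩ := f.2.2 _ (isUBounded_subBall hs1)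
    refine ⟨max M 0, fun ψ hψ => ?_⟩
    have h1 := h.norm_lt ψ
    have h2 := hsupp (ι ψ) (proj0 p ψ) h1 s hs0 hs1 ?_
    · rw [h.section_proj] at h2
      exact h2 f _ (le_max_right _ _) fun y hy => (hM y hy).trans (le_max_left _ _)
    · have h3 := pow_add_pow_le (norm_nonneg (proj0 p ψ)) hδ.le hp0.ne'
      have h4 := pow_le_pow_left₀ (by positivity) (hle ψ hψ) p
      have h5 := hρ (ι ψ)
      linarith

end Distinguished

end BoundedType

end

theorem mainTheorem12 (p : ℕ) (hp : 1 < p) [Fact (1 ≤ (p : ℝ≥0∞))] :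
    -- ultrafilter limits along block bases are points of the spectrum
    (∀ (x : ℕ → BoundedType.unitBall p) (r : ℝ) (Γ : Ultrafilter ℕ),
      BoundedType.IsBlockData x r → (∀ n : ℕ, Set.Ici n ∈ Γ) →
        ∃ φ : BoundedType.Mb (BoundedType.unitBall p), BoundedType.IsLimitAlong x Γ φ) ∧
    -- the distinguished spectrum is open, and `π` makes it a Riemann domain over `ℓ_p`
    IsOpen (BoundedType.Mb0 p) ∧
    (∀ φ ∈ BoundedType.Mb0 p,
      NormedSpace.inclusionInDoubleDual ℂ (BoundedType.Ell p) (BoundedType.proj φ) =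
        BoundedType.bidualProj φ) ∧
    BoundedType.IsRiemannDomain (BoundedType.proj0 p) ∧
    -- the canonical extensions to the distinguished spectrum are of bounded type
    (∀ f : BoundedType.Hb (BoundedType.unitBall p),
      BoundedType.IsHbOn (BoundedType.proj0 p) (fun φ => BoundedType.gelfand f φ.1)) ∧
    -- every sheet projects exactly onto a ball
    (∀ (r : ℝ) (φ : BoundedType.Mb (BoundedType.unitBall p)), BoundedType.IsBlockLimit r φ →
      BoundedType.proj '' connectedComponent φ =
        Metric.ball 0 ((1 - r ^ p) ^ (1 / (p : ℝ)))) ∧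
    -- the distinguished spectrum is an `H_b`-domain of holomorphy
    BoundedType.IsHbDomainOfHolomorphy.{0, 0, w} (BoundedType.proj0 p) := by
  obtain ⟨r, ι, σ, h, -, hσ, -, hopen⟩ := BoundedType.exists_isBallUnion_mb0 (p := p) hp
  refine ⟨fun x r Γ hx hΓ => ?_, hopen, fun φ hφ => ?_, h.isRiemannDomain,
    BoundedType.isHbOn_gelfand hp, fun r φ hφ => hφ.proj_image_connectedComponent hp,
    h.isHbDomainOfHolomorphy⟩
  · have hΓ' : (Γ : Filter ℕ) ≤ atTop := by
      rw [atTop_basis.ge_iff]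
      exact fun n _ => hΓ n
    obtain ⟨φ, hφ⟩ := hx.exists_isLimit (z := 0) (by omega) hΓ' (by
      simpa [(show p ≠ 0 by omega)] using pow_lt_one₀ hx.2.1.le hx.2.2.1 (by omega))
    exact ⟨φ, fun f => by simpa only [add_zero, BoundedType.zeroExt_apply] using hφ f⟩
  · have h1 := (hσ (ι ⟨φ, hφ⟩)).bidualProj_eq _ (h.norm_lt ⟨φ, hφ⟩)
    simp only [h.section_proj] at h1
    exact h1.symm
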